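/- Let $m,n,s\in\mathbb N$, $f,g,\psi_1,\dots,\psi_s\in\mathbb R[x]=\mathbb R[x_1,\dots,x_m]$, $p\in\mathbb R[x,y]$ with $y=(y_1,\dots,y_n)$, and let $\mathbf Y\subset\mathbb R^n$ be compact. Consider the fractional semi-infinite polynomial program (FSIPP) $$r^\star:=\min_{x\in\mathbf K}\frac{f(x)}{g(x)},\qquad \mathbf K:=\{x\in\mathbb R^m : \psi_j(x)\le 0\ (1\le j\le s),\ p(x,y)\le 0\ \ \forall y\in\mathbf Y\},$$ and assume that its set $\mathbf S$ of minimizers is nonempty. A polynomial $h\in\mathbb R[x]$ is called s.o.s-convex if $\nabla^2h=H^{T}H$ for some $r\in\mathbb N$ and some $r\times m$ matrix $H$ with entries in $\mathbb R[x]$. Let $\Sigma^2[\cdot]$ denote the set of sums of squares of polynomials, $d_y:=\deg_y p$, $\mathbf d:=\max\{\deg f,\deg g,\deg\psi_1,\dots,\deg\psi_s,\deg_xp\}$ and $\mathcal C[x]:=\Sigma^2[x]\cap\mathbb R[x]_{2\mathbf d}$, where $\mathbb R[x]_{k}$ is the set of polynomials of degree at most $k$. Suppose that $f$, $-g$, all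 $\psi_j$, and $p(\cdot,y)$ for every $y\in\mathbf Y$ are s.o.s-convex, and that one of the following two cases holds. Case 1: $n=1$, $\mathbf Y=[-1,1]$; then let $$\mathcal C[y]:=\{\theta_0+\theta_1(1-y_1^2) : \theta_0,\theta_1\in\Sigma^2[y_1],\ \deg\theta_0\le 2\lceil d_y/2\rceil,\ \deg(\theta_1(1-y_1^2))\le 2\lceil d_y/2\rceil\}.$$ Case 2: $n>1$, $\mathbf Y=\{y\in\mathbb R^n:\phi(y)\ge0\}$ with $\deg\phi=2$ and $\phi(\bar y)>0$ for some $\bar y\in\mathbb R^n$, and $d_y=2$; then let $$\mathcal C[y]:=\{\theta+\lambda\phi : \lambda\ge0,\ \theta\in\Sigma^2[y],\ \deg\theta\le2\}.$$ For a set of polynomials $\mathcal C$ let $\mathcal C^*$ be the set of linear functionals on the polynomial ring that are nonnegative on $\mathcal C$. For linear functionals $\mathscr L$ on $\mathbb R[x]$ and $\mathscr H$ on $\mathbb R[y]$, let $\mathscr L(p)\in\mathbb R[y]$ and $\mathscr H(p)\in\mathbb R[x]$ be obtained by applying them to the monomials in $x$, respectively in $y$, of $p$. Define $$r^{\rm primal}:=\sup\Big\{\rho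 : f-\rho g+\mathscr H(p)+\sum_{j=1}^s\eta_j\psi_j\in\mathcal C[x],\ \rho\in\mathbb R,\ \mathscr H\in\mathcal C[y]^*,\ \eta\in\mathbb R_+^s\Big\},$$ $$r^{\rm dual}:=\inf\Big\{\mathscr L(f) : \mathscr L\in\mathcal C[x]^*,\ \mathscr L(g)=1,\ -\mathscr L(p)\in\mathcal C[y],\ \mathscr L(\psi_j)\le0\ (1\le j\le s)\Big\}.$$ Assume (A2): either $f\ge0$ and $g>0$ on $\mathbf K$, or $g$ is affine and $g>0$ on $\mathbf K$. Then: (i) $r^{\rm dual}=r^\star$; the infimum defining $r^{\rm dual}$ is attained; and every minimizer $\mathscr L^\star$ satisfies $\mathscr L^\star(1)>0$ and $$\frac{1}{\mathscr L^\star(1)}\big(\mathscr L^\star(x_1),\dots,\mathscr L^\star(x_m)\big)\in\mathbf S.$$ (ii) Suppose in addition that (A3) holds: there are a finite nonnegative Borel measure $\mu^\star$ supported on $\mathbf Y$ and $\eta^\star\in\mathbb R_+^s$ with $$\inf_{x\in\mathbb R^m}\Big(f(x)-r^\star g(x)+\int_{\mathbf Y}p(x,y)\,d\mu^\star(y)+\sum_{j=1}^s\eta^\star_j\psi_j(x)\Big)=0.$$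 Then $r^{\rm primal}=r^\star$, and the supremum defining $r^{\rm primal}$ is attained. -/

import Mathlib

open MvPolynomial MeasureTheory

noncomputable section

/-- The formal Hessian matrix of a polynomial. -/
def polyHessian {m : ℕ} (h : MvPolynomial (Fin m) ℝ) :
    Matrix (Fin m) (Fin m) (MvPolynomial (Fin m) ℝ) :=
  Matrix.of fun i j => pderiv i (pderiv j h)

/-- `h` is s.o.s-convex: its Hessian factors as `Hᵀ H` for some `r × m` matrix polynomial `H`. -/
def SOSConvex {m : ℕ} (h : MvPolynomial (Fin m) ℝ) : Prop :=
  ∃ (r : ℕ) (H : Matrix (Fin r) (Fin m) (MvPolynomial (Fin m) ℝ)),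
    polyHessian h = H.transpose * H

/-- For a linear functional `L` on `ℝ[σ]` and a polynomial `q` in the variables `σ` with
coefficients in `ℝ[τ]`, the polynomial `∑_α L(σ^α) q_α ∈ ℝ[τ]`. -/
def applyFunctional {σ τ : Type*} (L : MvPolynomial σ ℝ →ₗ[ℝ] ℝ)
    (q : MvPolynomial σ (MvPolynomial τ ℝ)) : MvPolynomial τ ℝ :=
  ∑ α ∈ q.support, L (monomial α 1) • q.coeff α

/-- The dual cone of a set of polynomials: the linear functionals on the whole
polynomial ring which are nonnegative on that set. -/
def dualCone {σ : Type*} (K : Set (MvPolynomial σ ℝ)) : Set (MvPolynomial σ ℝ →ₗ[ℝ] ℝ) :=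
  {L | ∀ h ∈ K, 0 ≤ L h}

/-- The data of a fractional semi-infinite polynomial program
`min f(x)/g(x)` subject to `ψ_j(x) ≤ 0` for all `j`, and `p(x,y) ≤ 0` for all `y ∈ Y`,
with `x ∈ ℝ^m`, `y ∈ ℝ^n`. In `p` the variables `Sum.inl i` are the `x_i`
and the variables `Sum.inr k` are the `y_k`. -/
structure FSIPP (m n s : ℕ) where
  f : MvPolynomial (Fin m) ℝ
  g : MvPolynomial (Fin m) ℝ
  ψ : Fin s → MvPolynomial (Fin m) ℝ
  p : MvPolynomial (Fin m ⊕ Fin n) ℝ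
  Y : Set (Fin n → ℝ)

namespace FSIPP

variable {m n s : ℕ} (P : FSIPP m n s)

/-- The feasible set. -/
def K : Set (Fin m → ℝ) :=
  {x | (∀ j, eval x (P.ψ j) ≤ 0) ∧ ∀ y ∈ P.Y, eval (Sum.elim x y) P.p ≤ 0}

/-- The objective `f(x)/g(x)`. -/
def obj (x : Fin m → ℝ) : ℝ := eval x P.f / eval x P.g

/-- The set of optimal solutions. -/
def S : Set (Fin m → ℝ) := {x | x ∈ P.K ∧ ∀ z ∈ P.K, P.obj x ≤ P.obj z}

/-- The optimal value (only used when `S` is nonempty, so that it is a minimum). -/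
def rStar : ℝ := sInf (P.obj '' P.K)

/-- `p` as a polynomial in `x` with coefficients in `ℝ[y]`. -/
def pX : MvPolynomial (Fin m) (MvPolynomial (Fin n) ℝ) :=
  sumAlgEquiv ℝ (Fin m) (Fin n) P.p

/-- `p` as a polynomial in `y` with coefficients in `ℝ[x]`. -/
def pY : MvPolynomial (Fin n) (MvPolynomial (Fin m) ℝ) :=
  sumAlgEquiv ℝ (Fin n) (Fin m) (rename Sum.swap P.p)

/-- The polynomial `p(·, y) ∈ ℝ[x]` for a fixed point `y`. -/
def pAt (y : Fin n → ℝ) : MvPolynomial (Fin m) ℝ :=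
  aeval (Sum.elim X fun k => C (y k)) P.p

/-- The degree of `p` in `x`. -/
def dx : ℕ := P.pX.totalDegree

/-- The degree of `p` in `y`. -/
def dy : ℕ := P.pY.totalDegree

/-- The maximal degree in `x` of the data. -/
def d : ℕ :=
  max (max P.f.totalDegree P.g.totalDegree)
    (max (Finset.univ.sup fun j => (P.ψ j).totalDegree) P.dx)

/-- Assumption (A2). -/
def A2 : Prop :=
  (∀ x ∈ P.K, 0 ≤ eval x P.f ∧ 0 < eval x P.g) ∨
    (P.g.totalDegree ≤ 1 ∧ ∀ x ∈ P.K, 0 < eval x P.g)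

/-- The Lagrangian `f(x) - r* g(x) + ∫_Y p(x,y) dμ(y) + ∑_j η_j ψ_j(x)`. -/
def lagrangian (x : Fin m → ℝ) (μ : Measure (Fin n → ℝ)) (η : Fin s → ℝ) : ℝ :=
  eval x P.f - P.rStar * eval x P.g + (∫ y in P.Y, eval (Sum.elim x y) P.p ∂μ)
    + ∑ j, η j * eval x (P.ψ j)

/-- Assumption (A3): there are a finite nonnegative Borel measure `μ` supported on `Y` and
`η ≥ 0` such that the infimum of the Lagrangian over `ℝ^m` is `0`. -/
def A3 : Prop :=
  ∃ (μ : Measure (Fin n → ℝ)) (η : Fin s → ℝ), IsFiniteMeasure μ ∧ μ P.Yᶜ = 0 ∧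
    (∀ j, 0 ≤ η j) ∧ IsGLB (Set.range fun x => P.lagrangian x μ η) 0

/-- All the data are s.o.s-convex in `x`. -/
def SOSConvexData : Prop :=
  SOSConvex P.f ∧ SOSConvex (-P.g) ∧ (∀ j, SOSConvex (P.ψ j)) ∧ ∀ y ∈ P.Y, SOSConvex (P.pAt y)

/-- Case 1: `n = 1`, `Y = [-1,1]`, s.o.s-convex data; `i` is the only index in `Fin n`. -/
def IsCase1 (i : Fin n) : Prop :=
  n = 1 ∧ P.Y = {y | y i ∈ Set.Icc (-1) 1} ∧ P.SOSConvexData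

/-- Case 2: `n > 1`, `Y = {φ ≥ 0}` with `φ` of degree two and positive somewhere, `p` of degree
two in `y`, s.o.s-convex data. -/
def IsCase2 (φ : MvPolynomial (Fin n) ℝ) : Prop :=
  1 < n ∧ P.Y = {y | 0 ≤ eval y φ} ∧ φ.totalDegree = 2 ∧ (∃ y, 0 < eval y φ) ∧
    P.dy = 2 ∧ P.SOSConvexData

/-- The cone of sums of squares in `ℝ[x]` of degree at most `2d`. -/
def coneX : Set (MvPolynomial (Fin m) ℝ) :=
  {h | IsSumSq h ∧ h.totalDegree ≤ 2 * P.d}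

/-- The cone in `ℝ[y]` for Case 1; `(d_y + 1) / 2` is `⌈d_y/2⌉`. -/
def coneY1 (i : Fin n) : Set (MvPolynomial (Fin n) ℝ) :=
  {h | ∃ θ₀ θ₁ : MvPolynomial (Fin n) ℝ, IsSumSq θ₀ ∧ IsSumSq θ₁ ∧
    θ₀.totalDegree ≤ 2 * ((P.dy + 1) / 2) ∧
    (θ₁ * (1 - X i ^ 2)).totalDegree ≤ 2 * ((P.dy + 1) / 2) ∧
    h = θ₀ + θ₁ * (1 - X i ^ 2)}

/-- Feasibility of `(ρ, H, η)` in the primal conic problem with cones `Cx`, `Cy`. -/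
def PrimalFeasible (Cx : Set (MvPolynomial (Fin m) ℝ)) (Cy : Set (MvPolynomial (Fin n) ℝ))
    (ρ : ℝ) (H : MvPolynomial (Fin n) ℝ →ₗ[ℝ] ℝ) (η : Fin s → ℝ) : Prop :=
  P.f - ρ • P.g + applyFunctional H P.pY + ∑ j, η j • P.ψ j ∈ Cx ∧
    H ∈ dualCone Cy ∧ ∀ j, 0 ≤ η j

/-- The optimal value of the primal conic problem, a supremum in `[-∞, ∞]`. -/
def rPrimal (Cx : Set (MvPolynomial (Fin m) ℝ)) (Cy : Set (MvPolynomial (Fin n) ℝ)) : EReal :=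
  sSup {r | ∃ ρ H η, P.PrimalFeasible Cx Cy ρ H η ∧ r = (ρ : EReal)}

/-- Feasibility of `L` in the dual conic problem with cones `Cx`, `Cy`. -/
def DualFeasible (Cx : Set (MvPolynomial (Fin m) ℝ)) (Cy : Set (MvPolynomial (Fin n) ℝ))
    (L : MvPolynomial (Fin m) ℝ →ₗ[ℝ] ℝ) : Prop :=
  L ∈ dualCone Cx ∧ L P.g = 1 ∧ -applyFunctional L P.pX ∈ Cy ∧ ∀ j, L (P.ψ j) ≤ 0

/-- The optimal value of the dual conic problem, an infimum in `[-∞, ∞]`. -/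
def rDual (Cx : Set (MvPolynomial (Fin m) ℝ)) (Cy : Set (MvPolynomial (Fin n) ℝ)) : EReal :=
  sInf {r | ∃ L, P.DualFeasible Cx Cy L ∧ r = (L P.f : EReal)}

/-- `L` is a minimizer of the dual conic problem. -/
def IsDualMinimizer (Cx : Set (MvPolynomial (Fin m) ℝ)) (Cy : Set (MvPolynomial (Fin n) ℝ))
    (L : MvPolynomial (Fin m) ℝ →ₗ[ℝ] ℝ) : Prop :=
  P.DualFeasible Cx Cy L ∧ ∀ L', P.DualFeasible Cx Cy L' → L P.f ≤ L' P.f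

end FSIPP

/-- The cone in `ℝ[y]` for Case 2. -/
def coneY2 {n : ℕ} (φ : MvPolynomial (Fin n) ℝ) : Set (MvPolynomial (Fin n) ℝ) :=
  {h | ∃ (θ : MvPolynomial (Fin n) ℝ) (c : ℝ), IsSumSq θ ∧ θ.totalDegree ≤ 2 ∧ 0 ≤ c ∧
    h = θ + c • φ}

end

/-! Let `𝓛` be a linear functional which is nonnegative on the sums of squares of degree at most
`2d`, normalized so that `𝓛 1 = 1`, and put `a i = 𝓛 (x_i)`. If `h` is s.o.s-convex, then its
first-order remainder `h - h(a) - ∇h(a)ᵀ (x - a)` at `a` is a sum of squares: by Taylor's formula it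
is `∫₀¹ (1 - t) wₜ dt`, where the second derivative `wₜ` of `h` at `a + t (x - a)` in the direction
`x - a` is a sum of squares, and a finite-dimensional convex cone absorbs such an integral.
Applying `𝓛` gives Jensen's inequality `h(a) ≤ 𝓛 h`.

On `Y` the cone `𝒞[y]` captures every nonnegative polynomial of degree at most `d_y` (Lukács'
theorem on `[-1, 1]`, the S-lemma for a quadratic constraint). Jensen's inequality then
makes `a` feasible for every dual feasible `𝓛`, with objective value at most `𝓛 f`. For the primal
problem, the Lagrangian of (A3) attains its infimum `0` at every minimizer, so it equals its own
first-order remainder there, which is a nonnegative combination and integral of sums of squares. -/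

section SumsOfSquares

theorem isSumSq_map {A B F : Type*} [CommRing A] [CommRing B] [FunLike F A B] [RingHomClass F A B]
    (φ : F) {a : A} (ha : IsSumSq a) : IsSumSq (φ a) := by
  induction ha with
  | zero => simp
  | sq_add b _ ih => simpa using ih.sq_add (φ b)

theorem isSumSq_algebraMap_of_nonneg {A : Type*} [CommRing A] [Algebra ℝ A] {c : ℝ} (hc : 0 ≤ c) :
    IsSumSq (algebraMap ℝ A c) := by
  rw [← Real.mul_self_sqrt hc, map_mul]
  exact IsSumSq.mul_self _

theorem eval_nonneg_of_isSumSq {σ : Type*} {h : MvPolynomial σ ℝ} (hh : IsSumSq h) (x : σ → ℝ) :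
    0 ≤ eval x h :=
  (isSumSq_map (eval x) hh).nonneg

/-- The sums of squares of a real algebra, bundled as a convex cone. -/
def sumSqCone (A : Type*) [CommRing A] [Algebra ℝ A] : PointedCone ℝ A where
  carrier := {a | IsSumSq a}
  add_mem' := IsSumSq.add
  zero_mem' := IsSumSq.zero
  smul_mem' c a ha := by
    change IsSumSq ((c : ℝ) • a)
    rw [Algebra.smul_def]
    exact (isSumSq_algebraMap_of_nonneg c.2).mul ha

/-- The convex cone of the sums of squares of degree at most `k` among the real polynomials. -/
def sosCone (σ : Type*) (k : ℕ) : PointedCone ℝ (MvPolynomial σ ℝ) where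
  carrier := {h | IsSumSq h ∧ h.totalDegree ≤ k}
  add_mem' ha hb := ⟨ha.1.add hb.1, (totalDegree_add _ _).trans (max_le ha.2 hb.2)⟩
  zero_mem' := ⟨IsSumSq.zero, by simp⟩
  smul_mem' c a ha := ⟨(sumSqCone _).smul_mem c.2 ha.1, (totalDegree_smul_le (c : ℝ) a).trans ha.2⟩

end SumsOfSquares

section ConeIntegration

theorem convexHull_range_eq_image_stdSimplex {ι E : Type*} [Fintype ι] [AddCommGroup E]
    [Module ℝ E] (z : ι → E) :
    convexHull ℝ (Set.range z) = Fintype.linearCombination ℝ z '' stdSimplex ℝ ι := by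
  classical
  rw [← convexHull_rangle_single_eq_stdSimplex, LinearMap.image_convexHull, ← Set.range_comp]
  congr 2
  ext i
  simp

variable {E : Type*} [NormedAddCommGroup E] [NormedSpace ℝ E] [FiniteDimensional ℝ E]

theorem exists_fin_mem_convexHull_range {s : Set E} {x : E} (hx : x ∈ convexHull ℝ s) :
    ∃ z : Fin (Module.finrank ℝ E + 1) → E, (∀ i, z i ∈ s) ∧ x ∈ convexHull ℝ (Set.range z) := by
  obtain ⟨ι, _, z, w, hzs, hind, hw, hw1, rfl⟩ := eq_pos_convex_span_of_mem_convexHull hx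
  have hcard : Fintype.card ι ≤ Module.finrank ℝ E + 1 :=
    hind.card_le_finrank_succ.trans (Nat.succ_le_succ (Submodule.finrank_le _))
  have : Nonempty ι := by
    by_contra hι
    rw [not_nonempty_iff] at hι
    simp at hw1
  obtain ⟨e⟩ : Nonempty (ι ↪ Fin (Module.finrank ℝ E + 1)) :=
    Function.Embedding.nonempty_of_card_le (by simpa using hcard)
  refine ⟨z ∘ Function.invFun e, fun i => hzs ⟨_, rfl⟩, ?_⟩
  rw [(Function.invFun_surjective e.injective).range_comp]
  exact (convex_convexHull ℝ _).sum_mem (fun i _ => (hw i).le) hw1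
    fun i _ => subset_convexHull ℝ _ ⟨i, rfl⟩

theorem isCompact_convexHull {s : Set E} (hs : IsCompact s) : IsCompact (convexHull ℝ s) := by
  let ι := Fin (Module.finrank ℝ E + 1)
  let combine : (ι → ℝ) × (ι → E) → E := fun q => Fintype.linearCombination ℝ q.2 q.1
  have hcombine : Continuous combine := by
    simp only [combine, Fintype.linearCombination_apply]
    fun_prop
  suffices convexHull ℝ s = combine '' (stdSimplex ℝ ι ×ˢ Set.univ.pi fun _ => s) by
    rw [this]
    exact ((isCompact_stdSimplex ℝ ι).prod (isCompact_univ_pi fun _ => hs)).image hcombine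
  apply Set.Subset.antisymm
  · intro x hx
    obtain ⟨z, hz, hxz⟩ := exists_fin_mem_convexHull_range hx
    rw [convexHull_range_eq_image_stdSimplex] at hxz
    obtain ⟨w, hw, rfl⟩ := hxz
    exact ⟨(w, z), ⟨hw, fun i _ => hz i⟩, rfl⟩
  · rintro _ ⟨⟨w, z⟩, ⟨hw, hz⟩, rfl⟩
    have hzs : Set.range z ⊆ s := Set.range_subset_iff.2 fun i => hz i trivial
    refine convexHull_mono hzs ?_
    rw [convexHull_range_eq_image_stdSimplex]
    exact ⟨w, hw, rfl⟩

/-- `C` need not be closed, since the convex hull of the compact set `f '' Y` is. -/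
theorem setIntegral_mem_of_forall_mem {X : Type*} [TopologicalSpace X] [T2Space X]
    [MeasurableSpace X] [OpensMeasurableSpace X] {Y : Set X} (hY : IsCompact Y)
    (μ : Measure X) [IsFiniteMeasureOnCompacts μ] (C : PointedCone ℝ E) {f : X → E}
    (hf : ContinuousOn f Y) (hC : ∀ y ∈ Y, f y ∈ C) : ∫ y in Y, f y ∂μ ∈ C := by
  by_cases hμY : μ Y = 0
  · simp [Measure.restrict_eq_zero.2 hμY]
  have haverage : ⨍ y in Y, f y ∂μ ∈ convexHull ℝ (f '' Y) := by
    refine (convex_convexHull ℝ _).set_average_mem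
      (isCompact_convexHull (hY.image_of_continuousOn hf)).isClosed hμY hY.measure_ne_top ?_
      (hf.integrableOn_compact hY)
    exact (ae_restrict_mem hY.measurableSet).mono fun y hy => subset_convexHull ℝ _ ⟨y, hy, rfl⟩
  have hintegral : ∫ y in Y, f y ∂μ = μ.real Y • ⨍ y in Y, f y ∂μ := by
    have hreal : μ.real Y ≠ 0 := (measureReal_ne_zero_iff hY.measure_ne_top).2 hμY
    rw [setAverage_eq, smul_smul, mul_inv_cancel₀ hreal, one_smul]
  rw [hintegral]
  exact C.smul_mem measureReal_nonneg
    (convexHull_min (Set.image_subset_iff.2 hC) C.convex haverage)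

theorem sum_setIntegral_smul_mem {X V ι : Type*} [TopologicalSpace X] [T2Space X]
    [MeasurableSpace X] [OpensMeasurableSpace X] {Y : Set X} (hY : IsCompact Y)
    (μ : Measure X) [IsFiniteMeasureOnCompacts μ] [AddCommGroup V] [Module ℝ V]
    (C : PointedCone ℝ V) [Fintype ι] {c : ι → X → ℝ} (hc : ∀ i, ContinuousOn (c i) Y) (v : ι → V)
    (hC : ∀ y ∈ Y, ∑ i, c i y • v i ∈ C) : ∑ i, (∫ y in Y, c i y ∂μ) • v i ∈ C := by
  have hcont : ContinuousOn (fun y i => c i y) Y := continuousOn_pi.2 hc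
  have hmem := setIntegral_mem_of_forall_mem hY μ
    (C.comap (Fintype.linearCombination ℝ v)) hcont fun y hy => by
      simpa [Fintype.linearCombination_apply] using hC y hy
  have hcoord (i : ι) : (∫ y in Y, (fun i => c i y) ∂μ) i = ∫ y in Y, c i y ∂μ :=
    eval_integral (fun i => (hc i).integrableOn_compact hY) i
  simpa [Fintype.linearCombination_apply, hcoord] using hmem

end ConeIntegration

section FirstOrderRemainder

section Line

variable {σ A : Type*} [CommRing A] [Algebra ℝ A]

/-- The restriction of polynomial functions to the line `t ↦ a + t v` in the `A`-points of affine
space. The chain rule and Taylor's formula along lines are stated through it. -/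
noncomputable def lineHom (a v : σ → A) : MvPolynomial σ ℝ →ₐ[ℝ] Polynomial A :=
  aeval fun i => Polynomial.C (a i) + Polynomial.C (v i) * Polynomial.X

theorem eval_lineHom (a v : σ → A) (h : MvPolynomial σ ℝ) (t : A) :
    (lineHom a v h).eval t = aeval (fun i => a i + v i * t) h := by
  have := comp_aeval_apply (fun i => Polynomial.C (a i) + Polynomial.C (v i) * Polynomial.X)
    ((Polynomial.aeval t).restrictScalars ℝ) h
  simpa [lineHom, Polynomial.coe_aeval_eq_eval] using this

theorem derivative_lineHom [Fintype σ] (a v : σ → A) (h : MvPolynomial σ ℝ) :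
    Polynomial.derivative (lineHom a v h)
      = ∑ i, lineHom a v (pderiv i h) * Polynomial.C (v i) := by
  classical
  induction h using MvPolynomial.induction_on with
  | C c => simp [lineHom, IsScalarTower.algebraMap_apply ℝ A (Polynomial A)]
  | add p q hp hq => simp [hp, hq, add_mul, Finset.sum_add_distrib]
  | mul_X p j hp =>
    have hX : Polynomial.derivative (lineHom a v (X j)) = Polynomial.C (v j) := by simp [lineHom]
    have hpderiv (i : σ) : lineHom a v (pderiv i (p * X j)) * Polynomial.C (v i)
        = lineHom a v (pderiv i p) * Polynomial.C (v i) * lineHom a v (X j)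
          + if i = j then lineHom a v p * Polynomial.C (v j) else 0 := by
      split_ifs with hij <;> simp [pderiv_X, hij] <;> ring
    rw [map_mul, Polynomial.derivative_mul, hp, hX, Finset.sum_congr rfl fun i _ => hpderiv i]
    simp [Finset.sum_add_distrib, Finset.sum_mul]

theorem SOSConvex.isSumSq_derivative_derivative_lineHom {m : ℕ} {h : MvPolynomial (Fin m) ℝ}
    (hh : SOSConvex h) (a v : Fin m → A) :
    IsSumSq (Polynomial.derivative (Polynomial.derivative (lineHom a v h))) := by
  obtain ⟨r, H, hH⟩ := hh
  have hessian_entry (i j : Fin m) : pderiv i (pderiv j h) = ∑ k, H k i * H k j := by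
    simpa [polyHessian, Matrix.mul_apply] using congrFun (congrFun hH i) j
  have hsquares : Polynomial.derivative (Polynomial.derivative (lineHom a v h))
      = ∑ k, (∑ i, lineHom a v (H k i) * Polynomial.C (v i))
        * (∑ i, lineHom a v (H k i) * Polynomial.C (v i)) := by
    simp only [derivative_lineHom, map_sum, Polynomial.derivative_mul, Polynomial.derivative_C,
      mul_zero, add_zero, hessian_entry, map_mul, Finset.sum_mul, Finset.mul_sum]
    rw [Finset.sum_congr rfl fun i _ => Finset.sum_comm, Finset.sum_comm]
    refine Finset.sum_congr rfl fun k _ => Finset.sum_congr rfl fun i _ =>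
      Finset.sum_congr rfl fun j _ => by ring
  rw [hsquares]
  exact IsSumSq.sum_mul_self _ _

theorem eval_pderiv_eq_zero_of_isLocalMin [Finite σ] {h : MvPolynomial σ ℝ} {a : σ → ℝ}
    (hmin : IsLocalMin (fun x => eval x h) a) (i : σ) : eval a (pderiv i h) = 0 := by
  classical
  have := Fintype.ofFinite σ
  let e : σ → ℝ := Pi.single i 1
  have eval_line (q : MvPolynomial σ ℝ) (t : ℝ) :
      (lineHom a e q).eval t = eval (fun j => a j + e j * t) q := by
    rw [eval_lineHom, aeval_eq_eval]
  have hline : IsLocalMin (fun t => (lineHom a e h).eval t) 0 := by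
    simp only [eval_line]
    have hcont : ContinuousAt (fun (t : ℝ) j => a j + e j * t) 0 := by fun_prop
    exact IsLocalMin.comp_continuous (f := fun x => eval x h) (by simpa using hmin) hcont
  have hderiv := hline.deriv_eq_zero
  rw [Polynomial.deriv, derivative_lineHom, Polynomial.eval_finsetSum] at hderiv
  simpa only [Polynomial.eval_mul, Polynomial.eval_C, eval_line, mul_zero, add_zero, e,
    Pi.single_apply, mul_ite, mul_one, Finset.sum_ite_eq', Finset.mem_univ, if_true]
    using hderiv

end Line

section Taylor

theorem integral_one_sub_mul_pow (j : ℕ) :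
    ∫ t in (0 : ℝ)..1, (1 - t) * t ^ j = 1 / ((j + 1) * (j + 2)) := by
  have hsub (t : ℝ) : (1 - t) * t ^ j = t ^ j - t ^ (j + 1) := by ring
  simp only [hsub]
  rw [intervalIntegral.integral_sub (by simp) (by simp), integral_pow, integral_pow]
  push_cast
  simp only [one_pow, zero_pow (Nat.succ_ne_zero _)]
  field_simp
  ring

variable {A : Type*} [CommRing A] [Algebra ℝ A]

variable (A) in
/-- The functional `w ↦ ∫₀¹ (1 - t) w(t) dt` on polynomials over `A`, computed coefficientwise; it
sends `u''` to the remainder of the first-order Taylor expansion of `u`. -/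
noncomputable def taylorFunctional : Polynomial A →ₗ[ℝ] A :=
  Polynomial.lsum fun j => (∫ t in (0 : ℝ)..1, (1 - t) * t ^ j) • LinearMap.id

theorem taylorFunctional_monomial (j : ℕ) (a : A) :
    taylorFunctional A (Polynomial.monomial j a) = (∫ t in (0 : ℝ)..1, (1 - t) * t ^ j) • a := by
  simp [taylorFunctional]

theorem taylorFunctional_derivative_derivative (u : Polynomial A) :
    taylorFunctional A (Polynomial.derivative (Polynomial.derivative u))
      = u.eval 1 - u.eval 0 - (Polynomial.derivative u).eval 0 := by
  induction u using Polynomial.induction_on' with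
  | add p q hp hq =>
    simp only [map_add, Polynomial.eval_add, hp, hq]
    ring
  | monomial j a =>
    rcases j with _ | _ | j
    · simp
    · simp
    have hcoeff : a * ((j + 1 + 1 : ℕ) : A) * ((j + 1 : ℕ) : A)
        = (((j : ℝ) + 1) * (j + 2)) • a := by
      simp only [Algebra.smul_def, map_mul, map_add, map_natCast, map_one, map_ofNat]
      push_cast
      ring
    have hpos : ((j : ℝ) + 1) * (j + 2) ≠ 0 := by positivity
    simp only [Polynomial.derivative_monomial, Nat.add_sub_cancel, hcoeff,
      taylorFunctional_monomial, integral_one_sub_mul_pow, smul_smul, one_div,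
      inv_mul_cancel₀ hpos]
    simp

theorem isSumSq_taylorFunctional {w : Polynomial A} (hw : IsSumSq w) :
    IsSumSq (taylorFunctional A w) := by
  have hsum : taylorFunctional A w = ∑ j : Fin (w.natDegree + 1),
      (∫ t in Set.Icc (0 : ℝ) 1, (1 - t) * t ^ (j : ℕ)) • w.coeff j := by
    conv_lhs => rw [w.as_sum_range, Finset.sum_range, map_sum]
    simp only [taylorFunctional_monomial, intervalIntegral.integral_of_le zero_le_one,
      integral_Icc_eq_integral_Ioc]
  rw [hsum]
  refine sum_setIntegral_smul_mem isCompact_Icc volume (sumSqCone A)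
    (c := fun (j : Fin (w.natDegree + 1)) t => (1 - t) * t ^ (j : ℕ)) (fun j => by fun_prop) _
    fun t ht => ?_
  have heval : ∑ j : Fin (w.natDegree + 1), ((1 - t) * t ^ (j : ℕ)) • w.coeff j
      = (1 - t) • w.eval (algebraMap ℝ A t) := by
    rw [Polynomial.eval_eq_sum_range, Finset.sum_range, Finset.smul_sum]
    refine Finset.sum_congr rfl fun j _ => ?_
    rw [mul_smul, Algebra.smul_def (t ^ (j : ℕ)), map_pow, mul_comm (w.coeff j)]
  rw [heval]
  exact (sumSqCone A).smul_mem (sub_nonneg.2 ht.2)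
    (isSumSq_map (Polynomial.evalRingHom (algebraMap ℝ A t)) hw)

end Taylor

variable {σ : Type*} [Fintype σ]

/-- The remainder `h - h(a) - ∇h(a)ᵀ (x - a)` of the first-order expansion of `h` at `a`, as a
linear map in `h`. -/
noncomputable def firstOrderRemainder (a : σ → ℝ) : MvPolynomial σ ℝ →ₗ[ℝ] MvPolynomial σ ℝ where
  toFun h := h - C (eval a h) - ∑ i, C (eval a (pderiv i h)) * (X i - C (a i))
  map_add' h k := by
    simp only [map_add, add_mul, Finset.sum_add_distrib]
    ring
  map_smul' c h := by
    simp only [smul_eq_C_mul, pderiv_C_mul, map_mul, eval_C, RingHom.id_apply, mul_sub,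
      Finset.mul_sum, mul_assoc]

theorem firstOrderRemainder_apply (a : σ → ℝ) (h : MvPolynomial σ ℝ) :
    firstOrderRemainder a h
      = h - C (eval a h) - ∑ i, C (eval a (pderiv i h)) * (X i - C (a i)) := rfl

theorem taylorFunctional_derivative_derivative_lineHom (a : σ → ℝ) (h : MvPolynomial σ ℝ) :
    taylorFunctional _ (Polynomial.derivative (Polynomial.derivative
      (lineHom (fun i => C (a i)) (fun i => X i - C (a i)) h))) = firstOrderRemainder a h := by
  have eval_zero (q : MvPolynomial σ ℝ) :
      (lineHom (fun i => C (a i)) (fun i => X i - C (a i)) q).eval 0 = C (eval a q) := by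
    rw [eval_lineHom]
    simpa [Function.comp_def, aeval_eq_eval, algebraMap_eq]
      using aeval_algebraMap_apply (MvPolynomial σ ℝ) a q
  have eval_one :
      (lineHom (fun i => C (a i)) (fun i => X i - C (a i)) h).eval 1 = h := by
    simp [eval_lineHom]
  rw [taylorFunctional_derivative_derivative, derivative_lineHom, Polynomial.eval_finsetSum,
    firstOrderRemainder_apply, eval_one, eval_zero]
  simp only [Polynomial.eval_mul, eval_zero, Polynomial.eval_C]

theorem SOSConvex.isSumSq_firstOrderRemainder {m : ℕ} {h : MvPolynomial (Fin m) ℝ}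
    (hh : SOSConvex h) (a : Fin m → ℝ) : IsSumSq (firstOrderRemainder a h) := by
  rw [← taylorFunctional_derivative_derivative_lineHom]
  exact isSumSq_taylorFunctional (hh.isSumSq_derivative_derivative_lineHom _ _)

theorem totalDegree_firstOrderRemainder_le (a : σ → ℝ) (h : MvPolynomial σ ℝ) :
    (firstOrderRemainder a h).totalDegree ≤ h.totalDegree := by
  rw [firstOrderRemainder_apply]
  rcases Nat.eq_zero_or_pos h.totalDegree with h0 | h0
  · rw [totalDegree_eq_zero_iff_eq_C.1 h0]
    simp
  refine (totalDegree_sub _ _).trans (max_le ((totalDegree_sub _ _).trans (by simp)) ?_)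
  refine totalDegree_finsetSum_le fun i _ => (totalDegree_mul _ _).trans ?_
  rw [totalDegree_C, zero_add]
  exact (totalDegree_sub _ _).trans (by simpa using Nat.succ_le_of_lt h0)

theorem firstOrderRemainder_eq_self {h : MvPolynomial σ ℝ} {a : σ → ℝ}
    (hnonneg : ∀ x, 0 ≤ eval x h) (ha : eval a h = 0) : firstOrderRemainder a h = h := by
  have hmin : IsLocalMin (fun x => eval x h) a :=
    Filter.Eventually.of_forall fun x => by simpa only [ha] using hnonneg x
  simp [firstOrderRemainder_apply, ha, eval_pderiv_eq_zero_of_isLocalMin hmin]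

theorem sosConvex_of_totalDegree_le_one {m : ℕ} {h : MvPolynomial (Fin m) ℝ}
    (hd : h.totalDegree ≤ 1) : SOSConvex h := by
  refine ⟨0, 0, Matrix.ext fun i j => MvPolynomial.ext _ _ fun α => ?_⟩
  simp only [polyHessian, Matrix.of_apply, Matrix.mul_zero, Matrix.zero_apply]
  rw [coeff_pderiv, coeff_pderiv, coeff_zero, coeff_eq_zero_of_totalDegree_lt, zero_mul, zero_mul]
  refine hd.trans_lt ?_
  change 1 < Finsupp.degree _
  simp [map_add]

/-- The polynomials whose first-order remainder at `a` is a sum of squares of degree at most `k`. -/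
noncomputable def remainderCone (a : σ → ℝ) (k : ℕ) : PointedCone ℝ (MvPolynomial σ ℝ) :=
  (sosCone σ k).comap (firstOrderRemainder a)

theorem SOSConvex.mem_remainderCone {m k : ℕ} {h : MvPolynomial (Fin m) ℝ} (hh : SOSConvex h)
    (hk : h.totalDegree ≤ k) (a : Fin m → ℝ) : h ∈ remainderCone a k :=
  ⟨hh.isSumSq_firstOrderRemainder a, (totalDegree_firstOrderRemainder_le a h).trans hk⟩

end FirstOrderRemainder

section Interval

/-- `q` is a combination of the weights `a` and `b` with sums of squares as coefficients, both terms
having degree at most `d`. Lukács' theorem uses the weights `1`, `1 - X ^ 2` for even `d` and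
`1 - X`, `1 + X` for odd `d`. -/
def IsWeightedSumSq (a b : Polynomial ℝ) (d : ℕ) (q : Polynomial ℝ) : Prop :=
  ∃ s t : Polynomial ℝ, IsSumSq s ∧ IsSumSq t ∧ (s * a).natDegree ≤ d ∧ (t * b).natDegree ≤ d ∧
    q = s * a + t * b

namespace IsWeightedSumSq

variable {a b l q r : Polynomial ℝ} {d : ℕ}

theorem swap (h : IsWeightedSumSq a b d q) : IsWeightedSumSq b a d q := by
  obtain ⟨s, t, hs, ht, hsd, htd, rfl⟩ := h
  exact ⟨t, s, ht, hs, htd, hsd, add_comm _ _⟩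

theorem add (hq : IsWeightedSumSq a b d q) (hr : IsWeightedSumSq a b d r) :
    IsWeightedSumSq a b d (q + r) := by
  obtain ⟨s, t, hs, ht, hsd, htd, rfl⟩ := hq
  obtain ⟨s', t', hs', ht', hsd', htd', rfl⟩ := hr
  refine ⟨s + s', t + t', hs.add hs', ht.add ht', ?_, ?_, by ring⟩ <;>
    rw [add_mul] <;>
    exact (Polynomial.natDegree_add_le _ _).trans (max_le ‹_› ‹_›)

theorem mul_of_natDegree_le_one (h : IsWeightedSumSq a b d q) (hl : l.natDegree ≤ 1) :
    IsWeightedSumSq (l * a) (l * b) (d + 1) (l * q) := by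
  obtain ⟨s, t, hs, ht, hsd, htd, rfl⟩ := h
  refine ⟨s, t, hs, ht, ?_, ?_, by ring⟩ <;>
    rw [mul_left_comm, add_comm] <;>
    exact Polynomial.natDegree_mul_le.trans (add_le_add hl ‹_›)

theorem of_sq_mul_left (h : IsWeightedSumSq (l ^ 2 * a) b d q) : IsWeightedSumSq a b d q := by
  obtain ⟨s, t, hs, ht, hsd, htd, rfl⟩ := h
  exact ⟨s * l ^ 2, t, hs.mul (sq l ▸ IsSumSq.mul_self l), ht, by rwa [mul_assoc], htd, by ring⟩

theorem sq_mul (h : IsWeightedSumSq a b d q) (hl : l.natDegree ≤ 1) :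
    IsWeightedSumSq a b (d + 2) (l ^ 2 * q) := by
  have hll := (h.mul_of_natDegree_le_one hl).mul_of_natDegree_le_one hl
  simp only [← mul_assoc, ← sq] at hll
  exact hll.of_sq_mul_left.swap.of_sq_mul_left.swap

theorem C_even {c : ℝ} (hc : 0 ≤ c) (b : Polynomial ℝ) (d : ℕ) :
    IsWeightedSumSq 1 b d (Polynomial.C c) :=
  ⟨Polynomial.C c, 0, isSumSq_algebraMap_of_nonneg hc, IsSumSq.zero, by simp, by simp, by simp⟩

theorem C_odd {c : ℝ} (hc : 0 ≤ c) (d : ℕ) :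
    IsWeightedSumSq (1 - Polynomial.X) (1 + Polynomial.X) (d + 1) (Polynomial.C c) := by
  have hc2 : IsSumSq (Polynomial.C (c / 2)) :=
    isSumSq_algebraMap_of_nonneg (A := Polynomial ℝ) (by positivity : 0 ≤ c / 2)
  have hdeg {w : Polynomial ℝ} (hw : w.natDegree ≤ 1) :
      (Polynomial.C (c / 2) * w).natDegree ≤ d + 1 :=
    (Polynomial.natDegree_C_mul_le _ _).trans (hw.trans (Nat.le_add_left 1 d))
  refine ⟨_, _, hc2, hc2, hdeg (by compute_degree), hdeg (by compute_degree), ?_⟩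
  conv_lhs => rw [← add_halves c, Polynomial.C_add]
  ring

theorem one_sub_X_mul_even (h : IsWeightedSumSq 1 (1 - Polynomial.X ^ 2) d q) :
    IsWeightedSumSq (1 - Polynomial.X) (1 + Polynomial.X) (d + 1) ((1 - Polynomial.X) * q) := by
  have hw := h.mul_of_natDegree_le_one (l := 1 - Polynomial.X) (by compute_degree)
  rw [mul_one, show (1 - Polynomial.X) * (1 - Polynomial.X ^ 2)
    = (1 - Polynomial.X) ^ 2 * (1 + Polynomial.X : Polynomial ℝ) by ring] at hw
  exact hw.swap.of_sq_mul_left.swap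

theorem one_add_X_mul_even (h : IsWeightedSumSq 1 (1 - Polynomial.X ^ 2) d q) :
    IsWeightedSumSq (1 - Polynomial.X) (1 + Polynomial.X) (d + 1) ((1 + Polynomial.X) * q) := by
  have hw := h.mul_of_natDegree_le_one (l := 1 + Polynomial.X) (by compute_degree)
  rw [mul_one, show (1 + Polynomial.X) * (1 - Polynomial.X ^ 2)
    = (1 + Polynomial.X) ^ 2 * (1 - Polynomial.X : Polynomial ℝ) by ring] at hw
  exact hw.swap.of_sq_mul_left

theorem one_sub_X_mul_odd (h : IsWeightedSumSq (1 - Polynomial.X) (1 + Polynomial.X) d q) :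
    IsWeightedSumSq 1 (1 - Polynomial.X ^ 2) (d + 1) ((1 - Polynomial.X) * q) := by
  have hw := h.mul_of_natDegree_le_one (l := 1 - Polynomial.X) (by compute_degree)
  rw [← sq, ← mul_one ((1 - Polynomial.X) ^ 2),
    show (1 - Polynomial.X) * (1 + Polynomial.X) = (1 - Polynomial.X ^ 2 : Polynomial ℝ)
      by ring] at hw
  exact hw.of_sq_mul_left

theorem one_add_X_mul_odd (h : IsWeightedSumSq (1 - Polynomial.X) (1 + Polynomial.X) d q) :
    IsWeightedSumSq 1 (1 - Polynomial.X ^ 2) (d + 1) ((1 + Polynomial.X) * q) := by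
  have hw := h.swap.mul_of_natDegree_le_one (l := 1 + Polynomial.X) (by compute_degree)
  rw [← sq, ← mul_one ((1 + Polynomial.X) ^ 2),
    show (1 + Polynomial.X) * (1 - Polynomial.X) = (1 - Polynomial.X ^ 2 : Polynomial ℝ)
      by ring] at hw
  exact hw.of_sq_mul_left

end IsWeightedSumSq

theorem eval_nonneg_of_mul_eval_nonneg {p q : Polynomial ℝ} {a b c : ℝ} (hab : a < b)
    (hp : ∀ x ∈ Set.Icc a b, x ≠ c → 0 < p.eval x)
    (hpq : ∀ x ∈ Set.Icc a b, 0 ≤ (p * q).eval x) : ∀ x ∈ Set.Icc a b, 0 ≤ q.eval x := by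
  have hclosed : IsClosed {x : ℝ | 0 ≤ q.eval x} := isClosed_le continuous_const q.continuous
  have hsub : Set.Ioo a b ∩ {c}ᶜ ⊆ {x : ℝ | 0 ≤ q.eval x} := fun x hx => by
    have hx' := Set.Ioo_subset_Icc_self hx.1
    have := hpq x hx'
    rw [Polynomial.eval_mul] at this
    exact nonneg_of_mul_nonneg_right this (hp x hx' hx.2)
  have hdense : Set.Icc a b ⊆ closure (Set.Ioo a b ∩ {c}ᶜ) := by
    rw [← closure_Ioo hab.ne]
    exact closure_minimal ((dense_compl_singleton c).open_subset_closure_inter isOpen_Ioo)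
      isClosed_closure
  exact fun x hx => closure_minimal hsub hclosed (hdense hx)

theorem sq_X_sub_C_dvd_of_isLocalMin {u : Polynomial ℝ} {a : ℝ} (hroot : u.IsRoot a)
    (hmin : IsLocalMin (fun x => u.eval x) a) : (Polynomial.X - Polynomial.C a) ^ 2 ∣ u := by
  obtain ⟨t, rfl⟩ := Polynomial.dvd_iff_isRoot.2 hroot
  have hderiv := hmin.deriv_eq_zero
  rw [Polynomial.deriv] at hderiv
  have ht : t.IsRoot a := by simpa [Polynomial.derivative_mul] using hderiv
  rw [sq]
  exact mul_dvd_mul_left _ (Polynomial.dvd_iff_isRoot.2 ht)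

theorem exists_cofactor_of_nonneg_Icc_of_isRoot {u : Polynomial ℝ}
    (hu : ∀ x ∈ Set.Icc (-1 : ℝ) 1, 0 ≤ u.eval x) {a : ℝ} (ha : a ∈ Set.Icc (-1 : ℝ) 1)
    (hroot : u.IsRoot a) :
    ∃ l r : Polynomial ℝ, u = l * r ∧ (∀ x ∈ Set.Icc (-1 : ℝ) 1, 0 ≤ r.eval x) ∧
      (l = 1 - Polynomial.X ∨ l = 1 + Polynomial.X ∨ l = (Polynomial.X - Polynomial.C a) ^ 2) := by
  suffices ∃ l : Polynomial ℝ, l ∣ u ∧ (∀ x ∈ Set.Icc (-1 : ℝ) 1, x ≠ a → 0 < l.eval x) ∧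
      (l = 1 - Polynomial.X ∨ l = 1 + Polynomial.X ∨
        l = (Polynomial.X - Polynomial.C a) ^ 2) by
    obtain ⟨l, ⟨r, rfl⟩, hl, hcases⟩ := this
    exact ⟨l, r, rfl, eval_nonneg_of_mul_eval_nonneg (by norm_num) hl hu, hcases⟩
  rcases ha.2.eq_or_lt with rfl | ha1
  · refine ⟨1 - Polynomial.X, ?_, fun x hx hx1 => ?_, Or.inl rfl⟩
    · rw [← neg_dvd, neg_sub]
      simpa using Polynomial.dvd_iff_isRoot.2 hroot
    · simpa using hx.2.lt_of_ne hx1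
  rcases ha.1.eq_or_lt with rfl | ha2
  · refine ⟨1 + Polynomial.X, ?_, fun x hx hx1 => ?_, Or.inr (Or.inl rfl)⟩
    · simpa [add_comm] using Polynomial.dvd_iff_isRoot.2 hroot
    · simpa [neg_lt_iff_pos_add'] using hx.1.lt_of_ne hx1.symm
  refine ⟨(Polynomial.X - Polynomial.C a) ^ 2, sq_X_sub_C_dvd_of_isLocalMin hroot ?_,
    fun x _ hxa => ?_, Or.inr (Or.inr rfl)⟩
  · filter_upwards [Icc_mem_nhds ha2 ha1] with x hx
    rw [show u.eval a = 0 from hroot]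
    exact hu x hx
  · have := sub_ne_zero.2 hxa
    simp only [Polynomial.eval_pow, Polynomial.eval_sub, Polynomial.eval_X, Polynomial.eval_C]
    positivity

theorem exists_eq_C_add_mul_of_nonneg_Icc {q : Polynomial ℝ}
    (hq : ∀ x ∈ Set.Icc (-1 : ℝ) 1, 0 ≤ q.eval x) :
    ∃ (c a : ℝ) (l r : Polynomial ℝ), 0 ≤ c ∧ q = Polynomial.C c + l * r ∧
      (∀ x ∈ Set.Icc (-1 : ℝ) 1, 0 ≤ r.eval x) ∧
      (l = 1 - Polynomial.X ∨ l = 1 + Polynomial.X ∨ l = (Polynomial.X - Polynomial.C a) ^ 2) := by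
  obtain ⟨a, ha, hmin⟩ := isCompact_Icc.exists_isMinOn
    (Set.nonempty_Icc.2 (by norm_num : (-1 : ℝ) ≤ 1)) q.continuous.continuousOn
  obtain ⟨l, r, hlr, hr, hl⟩ := exists_cofactor_of_nonneg_Icc_of_isRoot
    (u := q - Polynomial.C (q.eval a)) (fun x hx => by simpa using hmin hx) ha (by simp)
  exact ⟨q.eval a, a, l, r, hq a ha, by rw [← hlr]; ring, hr, hl⟩

theorem isWeightedSumSq_C {c : ℝ} (hc : 0 ≤ c) (d : ℕ) :
    (Even d → IsWeightedSumSq 1 (1 - Polynomial.X ^ 2) d (Polynomial.C c)) ∧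
      (Odd d → IsWeightedSumSq (1 - Polynomial.X) (1 + Polynomial.X) d (Polynomial.C c)) := by
  refine ⟨fun _ => .C_even hc _ d, ?_⟩
  rintro ⟨e, rfl⟩
  exact .C_odd hc (2 * e)

/-- Lukács' theorem: subtracting the minimum creates a root in `[-1, 1]`, and splitting off its
factor lowers the degree. -/
theorem isWeightedSumSq_of_nonneg_Icc {d : ℕ} {q : Polynomial ℝ} (hd : q.natDegree ≤ d)
    (hq : ∀ x ∈ Set.Icc (-1 : ℝ) 1, 0 ≤ q.eval x) :
    (Even d → IsWeightedSumSq 1 (1 - Polynomial.X ^ 2) d q) ∧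
      (Odd d → IsWeightedSumSq (1 - Polynomial.X) (1 + Polynomial.X) d q) := by
  induction d using Nat.strong_induction_on generalizing q with
  | _ d ih =>
    obtain ⟨c, a, l, r, hc, rfl, hr, hl⟩ := exists_eq_C_add_mul_of_nonneg_Icc hq
    suffices h : (Even d → IsWeightedSumSq 1 (1 - Polynomial.X ^ 2) d (l * r)) ∧
        (Odd d → IsWeightedSumSq (1 - Polynomial.X) (1 + Polynomial.X) d (l * r)) from
      ⟨fun hd => ((isWeightedSumSq_C hc d).1 hd).add (h.1 hd),
        fun hd => ((isWeightedSumSq_C hc d).2 hd).add (h.2 hd)⟩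
    rcases eq_or_ne r 0 with rfl | hr0
    · simpa using isWeightedSumSq_C le_rfl d
    have hdeg (hl : 0 < l.natDegree) : l.natDegree + r.natDegree ≤ d := by
      rwa [Polynomial.natDegree_C_add,
        Polynomial.natDegree_mul (Polynomial.ne_zero_of_natDegree_gt hl) hr0] at hd
    rcases hl with rfl | rfl | rfl
    · rw [show (1 - Polynomial.X : Polynomial ℝ).natDegree = 1 by compute_degree!] at hdeg
      obtain ⟨e, rfl⟩ := Nat.exists_eq_add_of_le' (le_of_add_le_left (hdeg one_pos))
      obtain ⟨heven, hodd⟩ := ih e (by omega) (by omega) hr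
      exact ⟨fun h => (hodd (by grind)).one_sub_X_mul_odd,
        fun h => (heven (by grind)).one_sub_X_mul_even⟩
    · rw [show (1 + Polynomial.X : Polynomial ℝ).natDegree = 1 by compute_degree!] at hdeg
      obtain ⟨e, rfl⟩ := Nat.exists_eq_add_of_le' (le_of_add_le_left (hdeg one_pos))
      obtain ⟨heven, hodd⟩ := ih e (by omega) (by omega) hr
      exact ⟨fun h => (hodd (by grind)).one_add_X_mul_odd,
        fun h => (heven (by grind)).one_add_X_mul_even⟩
    · rw [Polynomial.natDegree_pow, Polynomial.natDegree_X_sub_C] at hdeg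
      obtain ⟨e, rfl⟩ := Nat.exists_eq_add_of_le' (le_of_add_le_left (hdeg two_pos))
      obtain ⟨heven, hodd⟩ := ih e (by omega) (by omega) hr
      exact ⟨fun h => (heven (by grind)).sq_mul (Polynomial.natDegree_X_sub_C_le a),
        fun h => (hodd (by grind)).sq_mul (Polynomial.natDegree_X_sub_C_le a)⟩

theorem totalDegree_polynomial_aeval_X_le {σ : Type*} (i : σ) (q : Polynomial ℝ) :
    (Polynomial.aeval (X i : MvPolynomial σ ℝ) q).totalDegree ≤ q.natDegree := by
  rw [Polynomial.aeval_eq_sum_range]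
  refine totalDegree_finsetSum_le fun j hj => (totalDegree_smul_le _ _).trans ?_
  rw [totalDegree_X_pow]
  exact Nat.lt_succ_iff.1 (Finset.mem_range.1 hj)

theorem exists_isSumSq_of_nonneg_Icc {σ : Type*} [Subsingleton σ] (i : σ) {k : ℕ}
    {h : MvPolynomial σ ℝ} (hd : h.totalDegree ≤ 2 * k)
    (hh : ∀ y : σ → ℝ, y i ∈ Set.Icc (-1) 1 → 0 ≤ eval y h) :
    ∃ θ₀ θ₁ : MvPolynomial σ ℝ, IsSumSq θ₀ ∧ IsSumSq θ₁ ∧ θ₀.totalDegree ≤ 2 * k ∧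
      (θ₁ * (1 - X i ^ 2)).totalDegree ≤ 2 * k ∧ h = θ₀ + θ₁ * (1 - X i ^ 2) := by
  set F : Polynomial ℝ →ₐ[ℝ] MvPolynomial σ ℝ := Polynomial.aeval (X i)
  obtain ⟨q, rfl, hqd⟩ : ∃ q : Polynomial ℝ, F q = h ∧ q.natDegree ≤ 2 * k := by
    refine ⟨aeval (fun _ => Polynomial.X) h, ?_, ?_⟩
    · rw [← AlgHom.comp_apply]
      refine (DFunLike.congr_fun (?_ : _ = AlgHom.id ℝ _) h)
      ext j
      simp [F, Subsingleton.elim j i]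
    · simpa using MvPolynomial.aeval_natDegree_le h hd (fun _ => (Polynomial.X : Polynomial ℝ))
        (n := 1) (by simp)
  have hq : ∀ x ∈ Set.Icc (-1 : ℝ) 1, 0 ≤ q.eval x := fun x hx => by
    have := hh (fun _ => x) hx
    rwa [Polynomial.aeval_def, Polynomial.hom_eval₂, eval_X,
      show (eval fun _ => x).comp (algebraMap ℝ (MvPolynomial σ ℝ)) = RingHom.id ℝ by
        ext; simp] at this
  obtain ⟨s, t, hs, ht, hsd, htd, rfl⟩ := (isWeightedSumSq_of_nonneg_Icc hqd hq).1 (by simp)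
  have hF : F (t * (1 - Polynomial.X ^ 2)) = F t * (1 - X i ^ 2) := by simp [F]
  refine ⟨F s, F t, isSumSq_map F hs, isSumSq_map F ht, ?_, ?_, ?_⟩
  · exact (totalDegree_polynomial_aeval_X_le i s).trans (by rwa [mul_one] at hsd)
  · exact hF ▸ (totalDegree_polynomial_aeval_X_le i _).trans htd
  · rw [map_add, mul_one, hF]

end Interval

section SLemma

section QuadraticForms

variable {V : Type*} [AddCommGroup V] [Module ℝ V] {Q R : QuadraticForm ℝ V}

theorem quadraticForm_add_smul (Q : QuadraticForm ℝ V) (z w : V) (t : ℝ) :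
    Q (z + t • w) = Q z + t * QuadraticMap.polar Q z w + t ^ 2 * Q w := by
  rw [QuadraticMap.map_add Q, QuadraticMap.polar_smul_right, QuadraticMap.map_smul]
  simp only [smul_eq_mul]
  ring

theorem exists_roots_of_neg_of_pos {a b c : ℝ} (ha : a < 0) (hc : 0 < c) :
    ∃ s t : ℝ, 0 < s ∧ 0 < t ∧ a + s * b + s ^ 2 * c = 0 ∧ a + (-t) * b + (-t) ^ 2 * c = 0 ∧
      c * (s * t) = -a := by
  have hdisc : b ^ 2 < b ^ 2 - 4 * a * c := by nlinarith [mul_pos (neg_pos.2 ha) hc]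
  set D := √(b ^ 2 - 4 * a * c)
  have hD2 : D ^ 2 = b ^ 2 - 4 * a * c := Real.sq_sqrt ((sq_nonneg b).trans hdisc.le)
  have hb := abs_lt.1 (Real.lt_sqrt_of_sq_lt (by rwa [sq_abs]) : |b| < D)
  refine ⟨(-b + D) / (2 * c), (b + D) / (2 * c), div_pos (by linarith) (by linarith),
    div_pos (by linarith) (by linarith), ?_, ?_, ?_⟩ <;>
  · field_simp
    linear_combination hD2

/-- On the line through `z` and `w` the form `R` has two zeros, on either side of `z`; a suitable
positive combination of the values of `Q` there cancels the term `QuadraticMap.polar Q z w`. -/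
theorem mul_le_mul_of_nonneg_imp_nonneg (h : ∀ z, 0 ≤ R z → 0 ≤ Q z) {z w : V} (hz : R z < 0)
    (hw : 0 < R w) : Q w * R z ≤ Q z * R w := by
  obtain ⟨s, t, hs, ht, hRs, hRt, hst⟩ :=
    exists_roots_of_neg_of_pos (b := QuadraticMap.polar R z w) hz hw
  have hQs := h (z + s • w) (by rw [quadraticForm_add_smul, hRs])
  have hQt := h (z + (-t) • w) (by rw [quadraticForm_add_smul, hRt])
  rw [quadraticForm_add_smul] at hQs hQt
  have hcomb : 0 ≤ (s + t) * (Q z + s * t * Q w) := by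
    nlinarith [mul_nonneg ht.le hQs, mul_nonneg hs.le hQt]
  have hnonneg := mul_nonneg hw.le (nonneg_of_mul_nonneg_right hcomb (by linarith))
  linear_combination hnonneg + Q w * hst

/-- The homogeneous S-lemma; the multiplier is the infimum of `Q w / R w` over `R w > 0`. -/
theorem exists_forall_mul_le_of_nonneg_imp_nonneg (h : ∀ z, 0 ≤ R z → 0 ≤ Q z) (hR : ∃ w, 0 < R w) :
    ∃ c : ℝ, 0 ≤ c ∧ ∀ z, c * R z ≤ Q z := by
  obtain ⟨w₀, hw₀⟩ := hR
  let ratios : Set ℝ := (fun w => Q w / R w) '' {w | 0 < R w}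
  have hnonneg : ∀ r ∈ ratios, 0 ≤ r := by
    rintro _ ⟨w, hw : 0 < R w, rfl⟩
    exact div_nonneg (h w hw.le) hw.le
  have hne : ratios.Nonempty := ⟨_, w₀, hw₀, rfl⟩
  refine ⟨sInf ratios, le_csInf hne hnonneg, fun z => ?_⟩
  rcases lt_trichotomy (R z) 0 with hz | hz | hz
  · rw [← div_le_iff_of_neg hz]
    refine le_csInf hne ?_
    rintro _ ⟨w, hw : 0 < R w, rfl⟩
    rw [le_div_iff₀ hw, div_mul_eq_mul_div, div_le_iff_of_neg hz]
    exact mul_le_mul_of_nonneg_imp_nonneg h hz hw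
  · rw [hz, mul_zero]
    exact h z hz.ge
  · rw [← le_div_iff₀ hz]
    exact csInf_le ⟨0, hnonneg⟩ ⟨z, hz, rfl⟩

theorem nonneg_of_forall_nonneg_quadratic {a b c : ℝ}
    (h : ∀ t, 0 ≤ t → 0 ≤ a + t * b + t ^ 2 * c) : 0 ≤ c := by
  by_contra! hc
  set t : ℝ := 1 + (|a| + |b|) / -c with ht
  have ht1 : 1 ≤ t := le_add_of_nonneg_right (div_nonneg (by positivity) (by linarith))
  have htc : t * c = c - |a| - |b| := by
    rw [ht, div_neg, add_mul, neg_mul, div_mul_cancel₀ _ hc.ne]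
    ring
  have := h t (by linarith)
  nlinarith [le_abs_self a, le_abs_self b, abs_nonneg a]

theorem nonneg_of_nonneg_on_hyperplane (ℓ : Module.Dual ℝ V)
    (h : ∀ z, ℓ z = 1 → 0 ≤ R z → 0 ≤ Q z) {z₀ : V} (hℓ : ℓ z₀ = 1) (hR : 0 ≤ R z₀) {z : V}
    (hz : 0 ≤ R z) : 0 ≤ Q z := by
  have of_kernel {w : V} (hw : ℓ w = 0) (hRw : 0 ≤ R w) (hpolar : 0 ≤ QuadraticMap.polar R z₀ w) :
      0 ≤ Q w := by
    refine nonneg_of_forall_nonneg_quadratic (a := Q z₀) (b := QuadraticMap.polar Q z₀ w)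
      fun t ht => ?_
    rw [← quadraticForm_add_smul]
    refine h _ (by simp [hℓ, hw]) ?_
    rw [quadraticForm_add_smul]
    positivity
  by_cases hz0 : ℓ z = 0
  · rcases le_total 0 (QuadraticMap.polar R z₀ z) with hpolar | hpolar
    · exact of_kernel hz0 hz hpolar
    · rw [← QuadraticMap.map_neg]
      exact of_kernel (by simp [hz0]) (by rwa [QuadraticMap.map_neg])
        (by rwa [QuadraticMap.polar_neg_right, Left.nonneg_neg_iff])
  · have hscaled : 0 ≤ Q ((ℓ z)⁻¹ • z) := by
      refine h _ (by simp [hz0]) ?_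
      rw [QuadraticMap.map_smul]
      exact mul_nonneg (mul_self_nonneg _) hz
    rw [QuadraticMap.map_smul] at hscaled
    exact nonneg_of_mul_nonneg_right hscaled (mul_self_pos.2 (inv_ne_zero hz0))

end QuadraticForms

theorem isSumSq_of_posSemidef {ι A : Type*} [Fintype ι] [CommRing A] [Algebra ℝ A]
    {M : Matrix ι ι ℝ} (hM : M.PosSemidef) (v : ι → A) :
    IsSumSq (∑ i, ∑ j, M i j • (v i * v j)) := by
  classical
  open scoped MatrixOrder Matrix.Norms.L2Operator in
  obtain ⟨B, rfl⟩ := CStarAlgebra.nonneg_iff_eq_star_mul_self.mp hM.nonneg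
  have hsum : ∑ i, ∑ j, (star B * B) i j • (v i * v j)
      = ∑ k, (∑ i, B k i • v i) * (∑ i, B k i • v i) := by
    simp only [Matrix.mul_apply, Matrix.star_apply, star_trivial, Finset.sum_smul,
      Finset.sum_mul_sum, smul_mul_smul_comm]
    rw [Finset.sum_congr rfl fun i _ => Finset.sum_comm, Finset.sum_comm]
  rw [hsum]
  exact IsSumSq.sum_mul_self _ _

variable {σ : Type*}

/-- The vector `(1, X₁, …, Xₙ)`, whose constant entry has the index `none`. -/
noncomputable def affineVars (σ : Type*) : Option σ → MvPolynomial σ ℝ := fun o => o.elim 1 X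

/-- The homogenized point `(1, y)`. -/
def affinePoint (y : σ → ℝ) : Option σ → ℝ := fun o => o.elim 1 y

theorem exists_eq_affinePoint {z : Option σ → ℝ} (hz : z none = 1) : ∃ y, z = affinePoint y :=
  ⟨z ∘ some, funext fun o => by cases o <;> simp [affinePoint, hz]⟩

theorem eval_affineVars (y : σ → ℝ) (o : Option σ) :
    eval y (affineVars σ o) = affinePoint y o := by
  cases o <;> simp [affineVars, affinePoint]

theorem totalDegree_affineVars_le (o : Option σ) : (affineVars σ o).totalDegree ≤ 1 := by
  cases o <;> simp [affineVars]

theorem exists_affineVars_mul_of_degree_ne_zero {α : σ →₀ ℕ} (hα : α.degree ≠ 0) :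
    ∃ (o : Option σ) (β : σ →₀ ℕ), β.degree + 1 = α.degree ∧
      monomial α (1 : ℝ) = affineVars σ o * monomial β 1 := by
  classical
  obtain ⟨i, hi⟩ : ∃ i, α i ≠ 0 := by
    rw [Ne, Finsupp.degree_eq_zero_iff] at hα
    exact Finsupp.ne_iff.1 hα
  obtain ⟨β, rfl⟩ := exists_add_of_le (Finsupp.single_le_iff.2 (Nat.one_le_iff_ne_zero.2 hi))
  exact ⟨some i, β, by simp [add_comm], by simp [affineVars, X, monomial_mul]⟩

theorem exists_monomial_eq_affineVars_mul {α : σ →₀ ℕ} (hα : α.degree ≤ 2) :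
    ∃ i j, monomial α (1 : ℝ) = affineVars σ i * affineVars σ j := by
  have of_degree_eq_zero {γ : σ →₀ ℕ} (hγ : γ.degree = 0) :
      monomial γ (1 : ℝ) = affineVars σ none := by
    rw [Finsupp.degree_eq_zero_iff] at hγ
    simp [hγ, affineVars]
  have mul_none (o : Option σ) : affineVars σ o * affineVars σ none = affineVars σ o := mul_one _
  by_cases h0 : α.degree = 0
  · exact ⟨none, none, by rw [of_degree_eq_zero h0, mul_none]⟩
  obtain ⟨i, β, hβ, hi⟩ := exists_affineVars_mul_of_degree_ne_zero h0
  by_cases h1 : β.degree = 0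
  · exact ⟨i, none, by rw [hi, of_degree_eq_zero h1]⟩
  obtain ⟨j, γ, hγ, hj⟩ := exists_affineVars_mul_of_degree_ne_zero h1
  exact ⟨i, j, by rw [hi, hj, of_degree_eq_zero (by omega), mul_none]⟩

variable [Fintype σ]

/-- The polynomial `vᵀ M v` with `v = (1, X₁, …, Xₙ)`. -/
noncomputable def quadPoly : Matrix (Option σ) (Option σ) ℝ →ₗ[ℝ] MvPolynomial σ ℝ where
  toFun M := ∑ i, ∑ j, M i j • (affineVars σ i * affineVars σ j)
  map_add' M N := by simp only [Matrix.add_apply, add_smul, Finset.sum_add_distrib]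
  map_smul' c M := by
    simp only [Matrix.smul_apply, smul_assoc, Finset.smul_sum, RingHom.id_apply]

theorem quadPoly_apply (M : Matrix (Option σ) (Option σ) ℝ) :
    quadPoly M = ∑ i, ∑ j, M i j • (affineVars σ i * affineVars σ j) := rfl

theorem quadPoly_transpose (M : Matrix (Option σ) (Option σ) ℝ) :
    quadPoly M.transpose = quadPoly M := by
  rw [quadPoly_apply, Finset.sum_comm]
  simp only [Matrix.transpose_apply, quadPoly_apply, mul_comm]

theorem eval_quadPoly [DecidableEq σ] (M : Matrix (Option σ) (Option σ) ℝ) (y : σ → ℝ) :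
    eval y (quadPoly M) = M.toQuadraticForm' (affinePoint y) := by
  simp only [quadPoly_apply, map_sum, smul_eval, map_mul, eval_affineVars,
    Matrix.toQuadraticForm', LinearMap.BilinMap.toQuadraticMap_apply, Matrix.toLinearMap₂'_apply,
    smul_eq_mul]
  exact Finset.sum_congr rfl fun i _ => Finset.sum_congr rfl fun j _ => by ring

theorem totalDegree_quadPoly_le (M : Matrix (Option σ) (Option σ) ℝ) :
    (quadPoly M).totalDegree ≤ 2 := by
  refine totalDegree_finsetSum_le fun i _ => totalDegree_finsetSum_le fun j _ => ?_
  exact (totalDegree_smul_le _ _).trans ((totalDegree_mul _ _).trans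
    (add_le_add (totalDegree_affineVars_le i) (totalDegree_affineVars_le j)))

theorem exists_quadPoly_eq {q : MvPolynomial σ ℝ} (hq : q.totalDegree ≤ 2) :
    ∃ M : Matrix (Option σ) (Option σ) ℝ, quadPoly M = q := by
  classical
  change q ∈ LinearMap.range quadPoly
  rw [q.as_sum]
  refine Submodule.sum_mem _ fun α hα => ?_
  obtain ⟨i, j, hij⟩ := exists_monomial_eq_affineVars_mul ((le_totalDegree hα).trans hq)
  rw [← mul_one (coeff α q), ← smul_eq_mul, ← smul_monomial, hij]
  exact Submodule.smul_mem _ _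
    ⟨Matrix.single i j 1, by simp [quadPoly_apply, Matrix.single_apply, ite_and]⟩

theorem exists_isSymm_quadPoly_eq {q : MvPolynomial σ ℝ} (hq : q.totalDegree ≤ 2) :
    ∃ M : Matrix (Option σ) (Option σ) ℝ, M.IsSymm ∧ quadPoly M = q := by
  obtain ⟨M, rfl⟩ := exists_quadPoly_eq hq
  refine ⟨(1 / 2 : ℝ) • (M + M.transpose), ?_, ?_⟩
  · simp [Matrix.IsSymm, Matrix.transpose_add, add_comm]
  · rw [map_smul, map_add, quadPoly_transpose, ← two_smul ℝ, smul_smul]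
    norm_num

/-- The S-lemma, reduced to the homogeneous one by passing from `y` to `(1, y)`. -/
theorem exists_isSumSq_add_smul_of_nonneg {τ : Type*} [Finite τ]
    {q φ : MvPolynomial τ ℝ} (hq : q.totalDegree ≤ 2) (hφ : φ.totalDegree ≤ 2)
    (hpos : ∃ y, 0 < eval y φ) (h : ∀ y, 0 ≤ eval y φ → 0 ≤ eval y q) :
    ∃ (θ : MvPolynomial τ ℝ) (c : ℝ), IsSumSq θ ∧ θ.totalDegree ≤ 2 ∧ 0 ≤ c ∧
      q = θ + c • φ := by
  classical
  have := Fintype.ofFinite τ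
  obtain ⟨M, hM, rfl⟩ := exists_isSymm_quadPoly_eq hq
  obtain ⟨N, hN, rfl⟩ := exists_isSymm_quadPoly_eq hφ
  simp only [eval_quadPoly] at hpos h
  obtain ⟨y₀, hy₀⟩ := hpos
  have himp : ∀ z, 0 ≤ N.toQuadraticForm' z → 0 ≤ M.toQuadraticForm' z := fun z =>
    nonneg_of_nonneg_on_hyperplane (LinearMap.proj none)
      (fun w hw => by
        obtain ⟨y, rfl⟩ := exists_eq_affinePoint hw
        exact h y)
      rfl hy₀.le
  obtain ⟨c, hc, hle⟩ := exists_forall_mul_le_of_nonneg_imp_nonneg himp ⟨_, hy₀⟩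
  have hpsd : (M - c • N).PosSemidef := by
    refine Matrix.PosSemidef.of_dotProduct_mulVec_nonneg ?_ fun z => ?_
    · rw [Matrix.IsHermitian, Matrix.conjTranspose_eq_transpose_of_trivial,
        Matrix.transpose_sub, Matrix.transpose_smul, hM.eq, hN.eq]
    · simpa [Matrix.toQuadraticForm', Matrix.toLinearMap₂'_apply', Matrix.sub_mulVec,
        Matrix.smul_mulVec] using hle z
  refine ⟨quadPoly (M - c • N), c, isSumSq_of_posSemidef hpsd _, totalDegree_quadPoly_le _, hc, ?_⟩
  rw [map_sub, map_smul, sub_add_cancel]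

end SLemma

section Functionals

variable {σ τ : Type*}

theorem totalDegree_map_le {A B : Type*} [CommSemiring A] [CommSemiring B] (F : A →+* B)
    (q : MvPolynomial σ A) : (map F q).totalDegree ≤ q.totalDegree :=
  Finset.sup_mono (support_map_subset F q)

theorem eval_applyFunctional (L : MvPolynomial σ ℝ →ₗ[ℝ] ℝ)
    (q : MvPolynomial σ (MvPolynomial τ ℝ)) (y : τ → ℝ) :
    eval y (applyFunctional L q) = L (map (eval y) q) := by
  conv_rhs => rw [q.as_sum, map_sum, map_sum]
  rw [applyFunctional, map_sum]
  refine Finset.sum_congr rfl fun α _ => ?_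
  rw [map_monomial, smul_eval, ← mul_one (eval y (coeff α q)), ← smul_eq_mul _ (1 : ℝ),
    ← smul_monomial, map_smul, smul_eq_mul, smul_eq_mul, mul_one, mul_comm]

theorem applyFunctional_smul (c : ℝ) (L : MvPolynomial σ ℝ →ₗ[ℝ] ℝ)
    (q : MvPolynomial σ (MvPolynomial τ ℝ)) :
    applyFunctional (c • L) q = c • applyFunctional L q := by
  simp [applyFunctional, Finset.smul_sum, mul_smul]

theorem applyFunctional_aeval (x : σ → ℝ) (q : MvPolynomial σ (MvPolynomial τ ℝ)) :
    applyFunctional (aeval x).toLinearMap q = eval (fun i => C (x i)) q := by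
  rw [applyFunctional, eval_eq]
  refine Finset.sum_congr rfl fun α _ => ?_
  simp [aeval_monomial, Finsupp.prod, smul_eq_C_mul, mul_comm]

theorem eval_C_comp_sumAlgEquiv (q : MvPolynomial (σ ⊕ τ) ℝ) (x : σ → ℝ) :
    eval (fun i => C (x i)) (sumAlgEquiv ℝ σ τ q) = aeval (Sum.elim (fun i => C (x i)) X) q := by
  induction q using MvPolynomial.induction_on with
  | C a => simp [MvPolynomial.algebraMap_eq]
  | add p q hp hq => simp [hp, hq]
  | mul_X p j hp => rcases j with j | j <;> simp [hp]

theorem map_eval_sumAlgEquiv (q : MvPolynomial (σ ⊕ τ) ℝ) (y : τ → ℝ) :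
    map (eval y) (sumAlgEquiv ℝ σ τ q) = aeval (Sum.elim X fun k => C (y k)) q := by
  induction q using MvPolynomial.induction_on with
  | C a => simp [MvPolynomial.algebraMap_eq]
  | add p q hp hq => simp [hp, hq]
  | mul_X p j hp => rcases j with j | j <;> simp [hp]

theorem eval_aeval_sumElim (q : MvPolynomial (σ ⊕ τ) ℝ) (x : σ → ℝ) (y : τ → ℝ) :
    eval x (aeval (Sum.elim X fun k => C (y k)) q) = eval (Sum.elim x y) q := by
  have hcomp : (aeval x).comp (aeval (Sum.elim X fun k => C (y k))) =
      (aeval (Sum.elim x y) : MvPolynomial (σ ⊕ τ) ℝ →ₐ[ℝ] ℝ) :=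
    algHom_ext fun j => by rcases j with j | j <;> simp
  simpa only [AlgHom.comp_apply, aeval_eq_eval] using DFunLike.congr_fun hcomp q

/-- Integration over the compact set `Y` as a linear functional on polynomials. -/
noncomputable def integralFunctional [Countable τ] {Y : Set (τ → ℝ)} (hY : IsCompact Y)
    (μ : Measure (τ → ℝ)) [IsFiniteMeasureOnCompacts μ] : MvPolynomial τ ℝ →ₗ[ℝ] ℝ where
  toFun q := ∫ y in Y, eval y q ∂μ
  map_add' q r := by
    have hint (q : MvPolynomial τ ℝ) : IntegrableOn (fun y => eval y q) Y μ :=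
      (MvPolynomial.continuous_eval q).continuousOn.integrableOn_compact hY
    simp only [map_add]
    exact integral_add (hint q) (hint r)
  map_smul' c q := by
    simp only [smul_eval, RingHom.id_apply, smul_eq_mul]
    exact integral_const_mul c _

theorem integralFunctional_apply [Countable τ] {Y : Set (τ → ℝ)} (hY : IsCompact Y)
    (μ : Measure (τ → ℝ)) [IsFiniteMeasureOnCompacts μ] (q : MvPolynomial τ ℝ) :
    integralFunctional hY μ q = ∫ y in Y, eval y q ∂μ := rfl

theorem applyFunctional_integralFunctional_mem [Countable τ] {Y : Set (τ → ℝ)} (hY : IsCompact Y)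
    (μ : Measure (τ → ℝ)) [IsFiniteMeasureOnCompacts μ] (K : PointedCone ℝ (MvPolynomial σ ℝ))
    {q : MvPolynomial τ (MvPolynomial σ ℝ)}
    (hq : ∀ y ∈ Y, applyFunctional (aeval y).toLinearMap q ∈ K) :
    applyFunctional (integralFunctional hY μ) q ∈ K := by
  have heval (y : τ → ℝ) : applyFunctional (aeval y).toLinearMap q
      = ∑ α : q.support, eval y (monomial (α : τ →₀ ℕ) 1) • q.coeff α := by
    rw [Finset.sum_coe_sort q.support fun α => eval y (monomial α 1) • q.coeff α]
    simp [applyFunctional, aeval_eq_eval]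
  rw [applyFunctional, ← Finset.sum_coe_sort]
  exact sum_setIntegral_smul_mem hY μ K
    (fun _ => (MvPolynomial.continuous_eval _).continuousOn) _ fun y hy => heval y ▸ hq y hy

/-- The point `(L(x_i) / L(1))_i`, the mean of `L` if `L` is integration against a finite measure.
It is the junk value `0` if `L 1 = 0`. -/
noncomputable def barycenter (L : MvPolynomial σ ℝ →ₗ[ℝ] ℝ) : σ → ℝ := fun i => L (X i) / L 1

theorem apply_C (L : MvPolynomial σ ℝ →ₗ[ℝ] ℝ) (c : ℝ) : L (C c) = c * L 1 := by
  rw [← mul_one (C c), ← smul_eq_C_mul, map_smul, smul_eq_mul]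

theorem apply_firstOrderRemainder_barycenter [Fintype σ] {L : MvPolynomial σ ℝ →ₗ[ℝ] ℝ}
    (hL : L 1 ≠ 0) (h : MvPolynomial σ ℝ) :
    L (firstOrderRemainder (barycenter L) h) = L h - eval (barycenter L) h * L 1 := by
  have hlinear (i : σ) (c : ℝ) : L (C c * (X i - C (barycenter L i))) = 0 := by
    rw [← smul_eq_C_mul, map_smul, map_sub, apply_C, barycenter, div_mul_cancel₀ _ hL, sub_self,
      smul_zero]
  simp [firstOrderRemainder_apply, apply_C, hlinear]

/-- Jensen's inequality: `L` is nonnegative on the first-order remainder of `h` at the barycenter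
and kills its linear part. -/
theorem SOSConvex.eval_barycenter_mul_le {m k : ℕ} {L : MvPolynomial (Fin m) ℝ →ₗ[ℝ] ℝ}
    (hL : L ∈ dualCone (sosCone (Fin m) k : Set _)) (hL1 : L 1 ≠ 0)
    {h : MvPolynomial (Fin m) ℝ} (hh : SOSConvex h) (hk : h.totalDegree ≤ k) :
    eval (barycenter L) h * L 1 ≤ L h := by
  rw [← sub_nonneg, ← apply_firstOrderRemainder_barycenter hL1]
  exact hL _ (hh.mem_remainderCone hk _)

theorem sq_apply_le_mul_apply_sq {k : ℕ} {L : MvPolynomial σ ℝ →ₗ[ℝ] ℝ}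
    (hL : L ∈ dualCone (sosCone σ (2 * k) : Set _)) {g : MvPolynomial σ ℝ}
    (hg : g.totalDegree ≤ k) : L g ^ 2 ≤ L 1 * L (g ^ 2) := by
  have hsq (t : ℝ) : 0 ≤ L 1 * (t * t) + (-2 * L g) * t + L (g ^ 2) := by
    have hmem : (g - C t) ^ 2 ∈ sosCone σ (2 * k) := by
      refine ⟨sq (g - C t) ▸ IsSumSq.mul_self _, (totalDegree_pow _ _).trans ?_⟩
      have hdeg : (g - C t).totalDegree ≤ k := (totalDegree_sub _ _).trans (by simpa)
      gcongr
    have hexpand : (g - C t) ^ 2 = C (t * t) + (-2 * t) • g + g ^ 2 := by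
      simp only [smul_eq_C_mul, map_mul, map_neg, map_ofNat]
      ring
    have := hL _ hmem
    rw [hexpand, map_add, map_add, map_smul, apply_C, smul_eq_mul] at this
    linarith
  have := discrim_le_zero hsq
  rw [discrim] at this
  linarith

theorem apply_one_pos_of_apply_ne_zero {k : ℕ} {L : MvPolynomial σ ℝ →ₗ[ℝ] ℝ}
    (hL : L ∈ dualCone (sosCone σ (2 * k) : Set _)) {g : MvPolynomial σ ℝ}
    (hg : g.totalDegree ≤ k) (hLg : L g ≠ 0) : 0 < L 1 := by
  refine (hL 1 ⟨IsSumSq.one, by simp⟩).lt_of_ne fun h0 => hLg ?_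
  have := sq_apply_le_mul_apply_sq hL hg
  rw [← h0, zero_mul] at this
  exact pow_eq_zero_iff two_ne_zero |>.1 (this.antisymm (sq_nonneg _))

end Functionals

namespace FSIPP

variable {m n s : ℕ} (P : FSIPP m n s)

theorem eval_pAt (x : Fin m → ℝ) (y : Fin n → ℝ) :
    eval x (P.pAt y) = eval (Sum.elim x y) P.p := eval_aeval_sumElim _ _ _

theorem map_eval_pX (y : Fin n → ℝ) : map (eval y) P.pX = P.pAt y := map_eval_sumAlgEquiv _ _

theorem eval_map_eval_pY (x : Fin m → ℝ) (y : Fin n → ℝ) :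
    eval y (map (eval x) P.pY) = eval (Sum.elim x y) P.p := by
  rw [pY, map_eval_sumAlgEquiv, eval_aeval_sumElim, eval_rename, Sum.elim_swap]

theorem applyFunctional_aeval_pX (x : Fin m → ℝ) :
    applyFunctional (aeval x).toLinearMap P.pX = map (eval x) P.pY := by
  rw [applyFunctional_aeval, pX, eval_C_comp_sumAlgEquiv, pY, map_eval_sumAlgEquiv, aeval_rename,
    Sum.elim_swap]

theorem applyFunctional_aeval_pY (y : Fin n → ℝ) :
    applyFunctional (aeval y).toLinearMap P.pY = P.pAt y := by
  rw [applyFunctional_aeval, pY, eval_C_comp_sumAlgEquiv, pAt, aeval_rename, Sum.elim_swap]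

theorem totalDegree_f_le : P.f.totalDegree ≤ P.d := by simp [d]

theorem totalDegree_g_le : P.g.totalDegree ≤ P.d := by simp [d]

theorem totalDegree_ψ_le (j : Fin s) : (P.ψ j).totalDegree ≤ P.d :=
  (Finset.le_sup (f := fun j => (P.ψ j).totalDegree) (Finset.mem_univ j)).trans
    ((le_max_left _ _).trans (le_max_right _ _))

theorem totalDegree_pAt_le (y : Fin n → ℝ) : (P.pAt y).totalDegree ≤ P.d := by
  rw [← map_eval_pX]
  exact (totalDegree_map_le _ _).trans ((le_max_right _ _).trans (le_max_right _ _))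

variable {P} {Cy : Set (MvPolynomial (Fin n) ℝ)}

theorem rStar_eq_obj {x : Fin m → ℝ} (hx : x ∈ P.S) : P.rStar = P.obj x :=
  IsLeast.csInf_eq ⟨⟨x, hx.1, rfl⟩, by rintro _ ⟨z, hz, rfl⟩; exact hx.2 z hz⟩

theorem A2.g_pos (hA2 : P.A2) {x : Fin m → ℝ} (hx : x ∈ P.K) : 0 < eval x P.g :=
  hA2.elim (fun h => (h x hx).2) fun h => h.2 x hx

/-- The cone `Cy` certifies nonnegativity on `Y`: all its elements are nonnegative on `Y`, and every
polynomial of degree at most `d_y` which is nonnegative on `Y` belongs to it. -/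
structure IsExactCone (P : FSIPP m n s) (Cy : Set (MvPolynomial (Fin n) ℝ)) : Prop where
  eval_nonneg : ∀ h ∈ Cy, ∀ y ∈ P.Y, 0 ≤ eval y h
  mem_of_nonneg : ∀ h : MvPolynomial (Fin n) ℝ, h.totalDegree ≤ P.dy →
    (∀ y ∈ P.Y, 0 ≤ eval y h) → h ∈ Cy

theorem IsExactCone.neg_map_eval_pY_mem (hCy : P.IsExactCone Cy) {x : Fin m → ℝ} (hx : x ∈ P.K) :
    -map (eval x) P.pY ∈ Cy := by
  refine hCy.mem_of_nonneg _ ?_ fun y hy => ?_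
  · rw [totalDegree_neg]
    exact totalDegree_map_le _ _
  · rw [map_neg, eval_map_eval_pY]
    exact neg_nonneg.2 (hx.2 y hy)

theorem IsCase1.isExactCone_coneY1 {i : Fin n} (h : P.IsCase1 i) :
    P.IsExactCone (P.coneY1 i) := by
  obtain ⟨hn, hY, -⟩ := h
  refine ⟨?_, fun h hd hh => ?_⟩
  · rintro _ ⟨θ₀, θ₁, h₀, h₁, -, -, rfl⟩ y hy
    obtain ⟨hlower, hupper⟩ : -1 ≤ y i ∧ y i ≤ 1 := by rwa [hY] at hy
    have hfactor : 0 ≤ 1 - y i ^ 2 := by nlinarith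
    simpa using add_nonneg (eval_nonneg_of_isSumSq h₀ y)
      (mul_nonneg (eval_nonneg_of_isSumSq h₁ y) hfactor)
  · subst hn
    rw [hY] at hh
    exact exists_isSumSq_of_nonneg_Icc i (hd.trans (by omega)) hh

theorem IsCase2.isExactCone_coneY2 {φ : MvPolynomial (Fin n) ℝ} (h : P.IsCase2 φ) :
    P.IsExactCone (coneY2 φ) := by
  obtain ⟨-, hY, hφ, hpos, hdy, -⟩ := h
  refine ⟨?_, fun h hd hh => ?_⟩
  · rintro _ ⟨θ, c, hθ, -, hc, rfl⟩ y hy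
    rw [hY] at hy
    rw [map_add, smul_eval]
    exact add_nonneg (eval_nonneg_of_isSumSq hθ y) (mul_nonneg hc hy)
  · rw [hY] at hh
    exact exists_isSumSq_add_smul_of_nonneg (hd.trans hdy.le) hφ.le hpos hh

theorem DualFeasible.apply_one_pos {L : MvPolynomial (Fin m) ℝ →ₗ[ℝ] ℝ}
    (hL : P.DualFeasible P.coneX Cy L) : 0 < L 1 :=
  apply_one_pos_of_apply_ne_zero hL.1 P.totalDegree_g_le (hL.2.1.symm ▸ one_ne_zero)

theorem DualFeasible.eval_barycenter_mul_le {L : MvPolynomial (Fin m) ℝ →ₗ[ℝ] ℝ}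
    (hL : P.DualFeasible P.coneX Cy L) {h : MvPolynomial (Fin m) ℝ} (hh : SOSConvex h)
    (hd : h.totalDegree ≤ P.d) : eval (barycenter L) h * L 1 ≤ L h :=
  hh.eval_barycenter_mul_le (k := 2 * P.d) hL.1 hL.apply_one_pos.ne' (by omega)

theorem DualFeasible.barycenter_mem_K (hψ : ∀ j, SOSConvex (P.ψ j))
    (hp : ∀ y ∈ P.Y, SOSConvex (P.pAt y)) (hCy : ∀ h ∈ Cy, ∀ y ∈ P.Y, 0 ≤ eval y h)
    {L : MvPolynomial (Fin m) ℝ →ₗ[ℝ] ℝ} (hL : P.DualFeasible P.coneX Cy L) :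
    barycenter L ∈ P.K := by
  refine ⟨fun j => ?_, fun y hy => ?_⟩
  · exact nonpos_of_mul_nonpos_left
      ((hL.eval_barycenter_mul_le (hψ j) (P.totalDegree_ψ_le j)).trans (hL.2.2.2 j))
      hL.apply_one_pos
  · have hpL : L (P.pAt y) ≤ 0 := by
      have := hCy _ hL.2.2.1 y hy
      rwa [map_neg, eval_applyFunctional, map_eval_pX, neg_nonneg] at this
    rw [← eval_pAt]
    exact nonpos_of_mul_nonpos_left
      ((hL.eval_barycenter_mul_le (hp y hy) (P.totalDegree_pAt_le y)).trans hpL)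
      hL.apply_one_pos

theorem DualFeasible.obj_barycenter_le (hf : SOSConvex P.f) (hg : SOSConvex (-P.g)) (hA2 : P.A2)
    {L : MvPolynomial (Fin m) ℝ →ₗ[ℝ] ℝ} (hL : P.DualFeasible P.coneX Cy L)
    (hK : barycenter L ∈ P.K) : P.obj (barycenter L) ≤ L P.f := by
  have hgpos := hA2.g_pos hK
  have hfL : eval (barycenter L) P.f * L 1 ≤ L P.f :=
    hL.eval_barycenter_mul_le hf P.totalDegree_f_le
  have one_le : 1 ≤ eval (barycenter L) P.g * L 1 := by
    have := hL.eval_barycenter_mul_le hg ((totalDegree_neg _).trans_le P.totalDegree_g_le)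
    rw [map_neg, map_neg, hL.2.1] at this
    linarith
  refine ((div_le_iff₀ hgpos).2 ?_).trans hfL
  suffices eval (barycenter L) P.f ≤ eval (barycenter L) P.f * (eval (barycenter L) P.g * L 1) by
    linarith
  rcases hA2 with hA2 | ⟨hdeg, -⟩
  · exact le_mul_of_one_le_right (hA2 _ hK).1 one_le
  · have le_one := hL.eval_barycenter_mul_le (sosConvex_of_totalDegree_le_one hdeg)
      P.totalDegree_g_le
    rw [hL.2.1] at le_one
    rw [le_one.antisymm one_le, mul_one]

theorem IsExactCone.exists_dualFeasible (hCy : P.IsExactCone Cy) {x : Fin m → ℝ} (hx : x ∈ P.K)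
    (hg : 0 < eval x P.g) : ∃ L, P.DualFeasible P.coneX Cy L ∧ L P.f = P.obj x := by
  have hinv : 0 ≤ (eval x P.g)⁻¹ := inv_nonneg.2 hg.le
  let L : MvPolynomial (Fin m) ℝ →ₗ[ℝ] ℝ := (eval x P.g)⁻¹ • (aeval x).toLinearMap
  have hL (h : MvPolynomial (Fin m) ℝ) : L h = (eval x P.g)⁻¹ * eval x h := by
    simp [L, aeval_eq_eval]
  have hpX : applyFunctional L P.pX = (eval x P.g)⁻¹ • map (eval x) P.pY := by
    rw [applyFunctional_smul, applyFunctional_aeval_pX]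
  refine ⟨L, ⟨fun h hh => ?_, ?_, hCy.mem_of_nonneg _ ?_ fun y hy => ?_, fun j => ?_⟩, ?_⟩
  · rw [hL]
    exact mul_nonneg hinv (eval_nonneg_of_isSumSq hh.1 x)
  · rw [hL, inv_mul_cancel₀ hg.ne']
  · rw [totalDegree_neg, hpX]
    exact (totalDegree_smul_le _ _).trans (totalDegree_map_le _ _)
  · rw [hpX, map_neg, smul_eval, eval_map_eval_pY, neg_nonneg]
    exact mul_nonpos_of_nonneg_of_nonpos hinv (hx.2 y hy)
  · rw [hL]
    exact mul_nonpos_of_nonneg_of_nonpos hinv (hx.1 j)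
  · rw [hL, obj, div_eq_inv_mul]

theorem dual_exact (hdata : P.SOSConvexData) (hCy : P.IsExactCone Cy) (hS : P.S.Nonempty)
    (hA2 : P.A2) :
    P.rDual P.coneX Cy = (P.rStar : EReal) ∧ (∃ L, P.IsDualMinimizer P.coneX Cy L) ∧
      ∀ L, P.IsDualMinimizer P.coneX Cy L → 0 < L 1 ∧ barycenter L ∈ P.S := by
  obtain ⟨hf, hg, hψ, hp⟩ := hdata
  obtain ⟨x, hx⟩ := hS
  have barycenter_mem {L} (hL : P.DualFeasible P.coneX Cy L) : barycenter L ∈ P.K :=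
    hL.barycenter_mem_K hψ hp hCy.eval_nonneg
  have obj_barycenter_le {L} (hL : P.DualFeasible P.coneX Cy L) : P.obj (barycenter L) ≤ L P.f :=
    hL.obj_barycenter_le hf hg hA2 (barycenter_mem hL)
  have obj_le {L} (hL : P.DualFeasible P.coneX Cy L) : P.obj x ≤ L P.f :=
    (hx.2 _ (barycenter_mem hL)).trans (obj_barycenter_le hL)
  obtain ⟨L₀, hL₀, hL₀f⟩ := hCy.exists_dualFeasible hx.1 (hA2.g_pos hx.1)
  refine ⟨IsLeast.csInf_eq ⟨⟨L₀, hL₀, by rw [hL₀f, rStar_eq_obj hx]⟩, ?_⟩,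
    ⟨L₀, hL₀, fun L hL => hL₀f.trans_le (obj_le hL)⟩,
    fun L hL => ⟨hL.1.apply_one_pos, barycenter_mem hL.1, fun z hz => ?_⟩⟩
  · rintro _ ⟨L, hL, rfl⟩
    rw [rStar_eq_obj hx]
    exact EReal.coe_le_coe_iff.2 (obj_le hL)
  · exact (obj_barycenter_le hL.1).trans (((hL.2 L₀ hL₀).trans_eq hL₀f).trans (hx.2 z hz))

theorem PrimalFeasible.le_obj (hCy : P.IsExactCone Cy) {ρ : ℝ}
    {H : MvPolynomial (Fin n) ℝ →ₗ[ℝ] ℝ} {η : Fin s → ℝ}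
    (h : P.PrimalFeasible P.coneX Cy ρ H η) {x : Fin m → ℝ} (hx : x ∈ P.K)
    (hg : 0 < eval x P.g) : ρ ≤ P.obj x := by
  obtain ⟨hmem, hH, hη⟩ := h
  have hHp : H (map (eval x) P.pY) ≤ 0 := by
    simpa using hH _ (hCy.neg_map_eval_pY_mem hx)
  have hηψ : ∑ j, η j * eval x (P.ψ j) ≤ 0 :=
    Finset.sum_nonpos fun j _ => mul_nonpos_of_nonneg_of_nonpos (hη j) (hx.1 j)
  have hnonneg := eval_nonneg_of_isSumSq hmem.1 x
  simp only [map_add, map_sub, smul_eval, eval_applyFunctional, map_sum] at hnonneg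
  rw [obj, le_div_iff₀ hg]
  linarith

variable (P) in
/-- The Lagrangian `f - r* g + H(p) + ∑_j η_j ψ_j` as a polynomial in `x`, with the measure
in `FSIPP.lagrangian` replaced by an arbitrary functional `H` on `ℝ[y]`. -/
noncomputable def lagrangianPoly (H : MvPolynomial (Fin n) ℝ →ₗ[ℝ] ℝ) (η : Fin s → ℝ) :
    MvPolynomial (Fin m) ℝ :=
  P.f - P.rStar • P.g + applyFunctional H P.pY + ∑ j, η j • P.ψ j

theorem eval_lagrangianPoly_integralFunctional (hY : IsCompact P.Y) (μ : Measure (Fin n → ℝ))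
    [IsFiniteMeasureOnCompacts μ] (η : Fin s → ℝ) (x : Fin m → ℝ) :
    eval x (P.lagrangianPoly (integralFunctional hY μ) η) = P.lagrangian x μ η := by
  simp only [lagrangianPoly, lagrangian, map_add, map_sub, smul_eval, eval_applyFunctional,
    integralFunctional_apply, eval_map_eval_pY, map_sum]

theorem lagrangian_nonpos (hY : MeasurableSet P.Y) (hA2 : P.A2) (μ : Measure (Fin n → ℝ))
    {η : Fin s → ℝ} (hη : ∀ j, 0 ≤ η j) {x : Fin m → ℝ} (hx : x ∈ P.S) :
    P.lagrangian x μ η ≤ 0 := by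
  have hfg : eval x P.f - P.rStar * eval x P.g = 0 := by
    rw [rStar_eq_obj hx, obj, div_mul_cancel₀ _ (hA2.g_pos hx.1).ne', sub_self]
  have hint : ∫ y in P.Y, eval (Sum.elim x y) P.p ∂μ ≤ 0 := setIntegral_nonpos hY hx.1.2
  have hηψ : ∑ j, η j * eval x (P.ψ j) ≤ 0 :=
    Finset.sum_nonpos fun j _ => mul_nonpos_of_nonneg_of_nonpos (hη j) (hx.1.1 j)
  rw [lagrangian]
  linarith

theorem neg_rStar_smul_g_mem_remainderCone (hg : SOSConvex (-P.g)) (hA2 : P.A2)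
    (hS : P.S.Nonempty) (a : Fin m → ℝ) : -(P.rStar • P.g) ∈ remainderCone a P.d := by
  have hneg : -P.g ∈ remainderCone a P.d :=
    hg.mem_remainderCone ((totalDegree_neg _).trans_le P.totalDegree_g_le) a
  rcases hA2 with hA2 | ⟨hdeg, -⟩
  · obtain ⟨x, hx⟩ := hS
    have rStar_nonneg : 0 ≤ P.rStar := by
      rw [rStar_eq_obj hx]
      exact div_nonneg (hA2 x hx.1).1 (hA2 x hx.1).2.le
    rw [← smul_neg]
    exact PointedCone.smul_mem _ rStar_nonneg hneg
  · have hpos : P.g ∈ remainderCone a P.d :=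
      (sosConvex_of_totalDegree_le_one hdeg).mem_remainderCone P.totalDegree_g_le a
    rcases le_total 0 P.rStar with h0 | h0
    · rw [← smul_neg]
      exact PointedCone.smul_mem _ h0 hneg
    · rw [← neg_smul]
      exact PointedCone.smul_mem _ (neg_nonneg.2 h0) hpos

theorem lagrangianPoly_mem_remainderCone (hdata : P.SOSConvexData) (hY : IsCompact P.Y)
    (hA2 : P.A2) (hS : P.S.Nonempty) (μ : Measure (Fin n → ℝ)) [IsFiniteMeasureOnCompacts μ]
    {η : Fin s → ℝ} (hη : ∀ j, 0 ≤ η j) (a : Fin m → ℝ) :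
    P.lagrangianPoly (integralFunctional hY μ) η ∈ remainderCone a P.d := by
  obtain ⟨hf, hg, hψ, hp⟩ := hdata
  rw [lagrangianPoly, sub_eq_add_neg]
  refine add_mem (add_mem (add_mem (hf.mem_remainderCone P.totalDegree_f_le a)
    (neg_rStar_smul_g_mem_remainderCone hg hA2 hS a)) ?_) (sum_mem fun j _ => ?_)
  · refine applyFunctional_integralFunctional_mem hY μ _ fun y hy => ?_
    rw [applyFunctional_aeval_pY]
    exact (hp y hy).mem_remainderCone (P.totalDegree_pAt_le y) a
  · exact PointedCone.smul_mem _ (hη j) ((hψ j).mem_remainderCone (P.totalDegree_ψ_le j) a)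

theorem exists_primalFeasible_rStar (hdata : P.SOSConvexData)
    (hCy : ∀ h ∈ Cy, ∀ y ∈ P.Y, 0 ≤ eval y h) (hY : IsCompact P.Y) (hS : P.S.Nonempty)
    (hA2 : P.A2) (hA3 : P.A3) : ∃ H η, P.PrimalFeasible P.coneX Cy P.rStar H η := by
  obtain ⟨μ, η, _, -, hη, hglb⟩ := hA3
  have ⟨x, hx⟩ := hS
  refine ⟨integralFunctional hY μ, η, ?_,
    fun h hh => setIntegral_nonneg hY.measurableSet (hCy h hh), hη⟩
  set Λ := P.lagrangianPoly (integralFunctional hY μ) η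
  have eval_nonneg (z : Fin m → ℝ) : 0 ≤ eval z Λ := by
    rw [eval_lagrangianPoly_integralFunctional]
    exact hglb.1 ⟨z, rfl⟩
  have eval_eq_zero : eval x Λ = 0 := (eval_nonneg x).antisymm' <| by
    rw [eval_lagrangianPoly_integralFunctional]
    exact lagrangian_nonpos hY.measurableSet hA2 μ hη hx
  have hmem : firstOrderRemainder x Λ ∈ sosCone (Fin m) P.d :=
    lagrangianPoly_mem_remainderCone hdata hY hA2 hS μ hη x
  rw [firstOrderRemainder_eq_self eval_nonneg eval_eq_zero] at hmem
  exact ⟨hmem.1, hmem.2.trans (by omega)⟩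

theorem primal_exact (hdata : P.SOSConvexData) (hCy : P.IsExactCone Cy) (hY : IsCompact P.Y)
    (hS : P.S.Nonempty) (hA2 : P.A2) (hA3 : P.A3) :
    P.rPrimal P.coneX Cy = (P.rStar : EReal) ∧
      ∃ H η, P.PrimalFeasible P.coneX Cy P.rStar H η := by
  obtain ⟨H, η, hfeasible⟩ := exists_primalFeasible_rStar hdata hCy.eval_nonneg hY hS hA2 hA3
  obtain ⟨x, hx⟩ := hS
  refine ⟨IsGreatest.csSup_eq ⟨⟨P.rStar, H, η, hfeasible, rfl⟩, ?_⟩, H, η, hfeasible⟩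
  rintro _ ⟨ρ, H', η', hρ, rfl⟩
  rw [rStar_eq_obj hx]
  exact EReal.coe_le_coe_iff.2 (hρ.le_obj hCy hx.1 (hA2.g_pos hx.1))

theorem sosConvexData_and_isExactCone
    (hcase : (∃ i : Fin n, P.IsCase1 i ∧ Cy = P.coneY1 i) ∨
      (∃ φ : MvPolynomial (Fin n) ℝ, P.IsCase2 φ ∧ Cy = coneY2 φ)) :
    P.SOSConvexData ∧ P.IsExactCone Cy := by
  rcases hcase with ⟨i, hcase, rfl⟩ | ⟨φ, hcase, rfl⟩
  · exact ⟨hcase.2.2, hcase.isExactCone_coneY1⟩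
  · exact ⟨hcase.2.2.2.2.2, hcase.isExactCone_coneY2⟩

end FSIPP

theorem mainTheorem4_general {m n s : ℕ} (P : FSIPP m n s) (Cy : Set (MvPolynomial (Fin n) ℝ))
    (hdata : P.SOSConvexData) (hCy : P.IsExactCone Cy) (hY : IsCompact P.Y)
    (hS : P.S.Nonempty) (hA2 : P.A2) :
    (P.rDual P.coneX Cy = (P.rStar : EReal) ∧
      (∃ L, P.IsDualMinimizer P.coneX Cy L) ∧
      ∀ L, P.IsDualMinimizer P.coneX Cy L →
        0 < L 1 ∧ (fun i => L (MvPolynomial.X i) / L 1) ∈ P.S) ∧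
    (P.A3 →
      P.rPrimal P.coneX Cy = (P.rStar : EReal) ∧
      ∃ H η, P.PrimalFeasible P.coneX Cy P.rStar H η) :=
  ⟨FSIPP.dual_exact hdata hCy hS hA2, FSIPP.primal_exact hdata hCy hY hS hA2⟩

theorem mainTheorem4 {m n s : ℕ} (P : FSIPP m n s)
    (Cy : Set (MvPolynomial (Fin n) ℝ))
    (hcase : (∃ i : Fin n, P.IsCase1 i ∧ Cy = P.coneY1 i) ∨
      (∃ φ : MvPolynomial (Fin n) ℝ, P.IsCase2 φ ∧ Cy = coneY2 φ))
    (hY : IsCompact P.Y) (hS : P.S.Nonempty) (hA2 : P.A2) :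
    (P.rDual P.coneX Cy = (P.rStar : EReal) ∧
      (∃ L, P.IsDualMinimizer P.coneX Cy L) ∧
      ∀ L, P.IsDualMinimizer P.coneX Cy L →
        0 < L 1 ∧ (fun i => L (MvPolynomial.X i) / L 1) ∈ P.S) ∧
    (P.A3 →
      P.rPrimal P.coneX Cy = (P.rStar : EReal) ∧
      ∃ H η, P.PrimalFeasible P.coneX Cy P.rStar H η) :=
  have ⟨hdata, hCy⟩ := FSIPP.sosConvexData_and_isExactCone hcase
  mainTheorem4_general P Cy hdata hCy hY hS hA2
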